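/- Let $r\ge 2$ and $s\ge 2$, and let $\mathfrak g=\mathfrak g_1\oplus\cdots\oplus\mathfrak g_s$ be the free nilpotent real Lie algebra of rank $r$, step $s$ and dimension $n$, with $\mathfrak g_{i+1}=[\mathfrak g_1,\mathfrak g_i]$. **Hall basis.** Fix a Hall basis $X_1,\dots,X_n$ of $\mathfrak g$: $X_1,\dots,X_r$ are generators, of degree $1$; the elements are numbered by non-decreasing degree (arbitrarily within one degree); and the elements of degree $d$, $2\le d\le s$, are the commutators $[X_i,X_j]$ of earlier elements with degrees adding up to $d$ such that $i>j$ and such that $k\le j$ whenever $X_i$ was constructed as $[X_h,X_k]$. Each $X_\ell$ is uniquely an iterated commutator $[\cdots[[X_{\ell_0},X_{\ell_1}],X_{\ell_2}],\dots,X_{\ell_h}]$ obtained by repeatedly expanding the left factor until a generator $X_{\ell_0}$ is reached; let $I(\ell)\in\mathbb N^n$ be the multi-index with $I(\ell)_j=\#\{m\ge 1:\ell_m=j\}$. **The group.** Identify the free nilpotent Lie group $G$ of $\mathfrak g$ with $\mathbb R^n$ through the exponential coordinates of the second type in which $X_1,\dots,X_n$ are the Hall–Grayson–Grossman vector fields: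 for $i\le r$, $$X_i(x)=\sum_{\ell:\ \ell_0=i}\frac{(-1)^{|I(\ell)|}}{I(\ell)!}\,x^{I(\ell)}\,\frac{\partial}{\partial x_\ell},$$ and the remaining $X_i$ are the commutators of vector fields prescribed by the Hall basis. Write $X_j=\sum_i X_{ji}\,\partial/\partial x_i$. **Extremal polynomials.** For $\alpha\in\mathbb N^n$ let $[X_i,X_\alpha]$ be the iterated commutator $[\cdots[X_i,X_1],\dots,X_1],X_2],\dots,X_n]$ in which each $X_j$ is bracketed on the right $\alpha_j$ times, let $c_{i\alpha}^k\in\mathbb R$ be given by $[X_i,X_\alpha]=\sum_k c_{i\alpha}^kX_k$, and for $v\in\mathbb R^n$ put $$P_i^v(x)=\sum_{\alpha\in\mathbb N^n}\frac{(-1)^{|\alpha|}}{\alpha!}\Big(\sum_{k=1}^n c_{i\alpha}^kv_k\Big)x^\alpha ,\qquad i=1,\dots,n,$$ a finite sum. Let $r_1=\dim\mathfrak g_1$ and $r_2=\dim\mathfrak g_2$. For $v\ne0$ the set $G_v=\{x\in\mathbb R^n: P_i^v(x)=0\text{ for all } i=1,\dots,r_1+r_2\}$ is called a Goh variety. **Goh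 extremals.** A Lipschitz curve $\gamma:[0,1]\to\mathbb R^n$ is horizontal if $\dot\gamma=\sum_{j=1}^r h_jX_j(\gamma)$ a.e. for some controls $h\in L^\infty([0,1];\mathbb R^r)$. A horizontal curve $\gamma$ is a Goh extremal if there is a Lipschitz curve $\xi:[0,1]\to\mathbb R^n$ with $\xi(t)\neq0$ for all $t$, with $$\dot\xi_k=-\sum_{j=1}^r\sum_{i=1}^n\frac{\partial X_{ji}}{\partial x_k}(\gamma)\,h_j\,\xi_i\quad\text{a.e. on }[0,1],\ k=1,\dots,n,$$ and with $\langle\xi,X_i(\gamma)\rangle=\langle\xi,[X_i,X_j](\gamma)\rangle=0$ on $[0,1]$ for all $i,j=1,\dots,r$. **Statement.** Let $\gamma:[0,1]\to G=\mathbb R^n$ be a horizontal curve with $\gamma(0)=0$. Then the following are equivalent: (A) $\gamma$ is a Goh extremal; (B) there is $v\in\mathbb R^n$, $v\neq0$, such that $P_i^v(\gamma(t))=0$ for all $i=1,\dots,r_1+r_2$ and all $t\in[0,1]$; (C) $\gamma([0,1])$ is contained in a Goh variety, that is, there is $v\in\mathbb R^n$, $v\ne0$, with $\gamma(t)\in G_v$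 for all $t\in[0,1]$. -/

import Mathlib

open MeasureTheory Set

/-- A Hall basis (M. Hall's algorithm) of the free nilpotent Lie algebra of rank `r`, step `s`
and dimension `n`, recorded through its indices.  The elements are numbered by `Fin n`, the first
`r` of them are the generators, `deg i` is the degree of the `i`-th element, and
`factors i = some (j, k)` says that the `i`-th element was constructed as the commutator of the
`j`-th and the `k`-th one.  The order of the elements inside one degree is arbitrary. -/
structure HallBasis (r s n : ℕ) where
  rank_le : r ≤ n
  deg : Fin n → ℕ
  factors : Fin n → Option (Fin n × Fin n)
  one_le_deg : ∀ i, 1 ≤ deg i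
  deg_le : ∀ i, deg i ≤ s
  lt_of_deg_lt : ∀ i j, deg i < deg j → i < j
  factors_eq_none_iff : ∀ i : Fin n, factors i = none ↔ (i : ℕ) < r
  deg_gen : ∀ i, factors i = none → deg i = 1
  deg_bracket : ∀ i j k, factors i = some (j, k) → deg i = deg j + deg k
  /-- The pairs whose commutator is a new basis element are exactly Hall's admissible pairs. -/
  exists_factors_iff : ∀ j k, (∃ i, factors i = some (j, k)) ↔
    deg j + deg k ≤ s ∧ k < j ∧ ∀ p q, factors j = some (p, q) → q ≤ k
  /-- Each admissible pair is used once. -/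
  factors_inj : ∀ i i' p, factors i = some p → factors i' = some p → i = i'

noncomputable section

namespace HallBasis

variable {r s n : ℕ} (H : HallBasis r s n)

theorem left_lt {i : Fin n} {p : Fin n × Fin n} (h : H.factors i = some p) : p.1 < i := by
  have h1 := H.deg_bracket i p.1 p.2 h
  have h2 := H.one_le_deg p.2
  exact H.lt_of_deg_lt _ _ (by omega)

theorem right_lt {i : Fin n} {p : Fin n × Fin n} (h : H.factors i = some p) : p.2 < i := by
  have h1 := H.deg_bracket i p.1 p.2 h
  have h2 := H.one_le_deg p.1
  exact H.lt_of_deg_lt _ _ (by omega)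

/-- The index of the `j`-th generator. -/
def gen (j : Fin r) : Fin n := Fin.castLE H.rank_le j

/-- The index `ℓ₀` in `X_ℓ = [⋯[[X_{ℓ₀}, X_{ℓ₁}], X_{ℓ₂}], …, X_{ℓ_h}]`, where `X_{ℓ₀}` is a
generator. -/
def head (l : Fin n) : Fin n :=
  match _h : H.factors l with
  | none => l
  | some p => head p.1
termination_by l
decreasing_by exact H.left_lt _h

/-- The multi-index `I(ℓ)`, which counts how often each index occurs among `ℓ₁, …, ℓ_h` in
`X_ℓ = [⋯[[X_{ℓ₀}, X_{ℓ₁}], X_{ℓ₂}], …, X_{ℓ_h}]`. -/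
def multiIndex (l : Fin n) : Fin n →₀ ℕ :=
  match _h : H.factors l with
  | none => 0
  | some p => multiIndex p.1 + Finsupp.single p.2 1
termination_by l
decreasing_by exact H.left_lt _h

end HallBasis

/-- Vector fields on `ℝⁿ` with polynomial coefficients, as derivations of the polynomial ring.
The vector field `Y = ∑ₖ Yₖ ∂/∂xₖ` has the coefficients `Yₖ = Y (X k)`, and `⁅Y, Z⁆ = YZ - ZY`. -/
abbrev PolyVectorField (n : ℕ) : Type :=
  Derivation ℝ (MvPolynomial (Fin n) ℝ) (MvPolynomial (Fin n) ℝ)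

/-- The coefficient of `∂/∂xₖ` in the vector field `Y`. -/
def PolyVectorField.coeff {n : ℕ} (Y : PolyVectorField n) (k : Fin n) : MvPolynomial (Fin n) ℝ :=
  Y (MvPolynomial.X k)

/-- The vector `Y(x) ∈ ℝⁿ`. -/
def PolyVectorField.at {n : ℕ} (Y : PolyVectorField n) (x : Fin n → ℝ) : Fin n → ℝ :=
  fun k => MvPolynomial.eval x (PolyVectorField.coeff Y k)

/-- `α! = α₁! ⋯ αₙ!`. -/
def multiFactorial {n : ℕ} (a : Fin n →₀ ℕ) : ℕ := ∏ j, (a j).factorial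

/-- `(-1)^{|α|} / α!`. -/
def signedInvFactorial {n : ℕ} (a : Fin n →₀ ℕ) : ℝ := (-1) ^ a.degree / (multiFactorial a : ℝ)

/-- The iterated commutator `[Y, X_α]`: the bracket on the right with `X₁` (`α₁` times), then with
`X₂` (`α₂` times), …, then with `Xₙ` (`αₙ` times). -/
def iterBracket {n : ℕ} {L : Type*} [LieRing L] (X : Fin n → L) (Y : L) (a : Fin n →₀ ℕ) : L :=
  (List.finRange n).foldl (fun Z j => (fun W => ⁅W, X j⁆)^[a j] Z) Y

/-- The coordinates of `Y` with respect to the family `X`, that is, the `c` with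
`Y = ∑ₖ cₖ Xₖ`. -/
def coordinates {n : ℕ} {V : Type*} [AddCommGroup V] [Module ℝ V] (X : Fin n → V) (Y : V) :
    Fin n → ℝ :=
  Function.invFun (fun c : Fin n → ℝ => ∑ k, c k • X k) Y

namespace HallBasis

variable {r s n : ℕ} (H : HallBasis r s n)

/-- The Grayson-Grossman vector fields
`X_i(x) = ∑_{ℓ : ℓ₀ = i} (-1)^{|I(ℓ)|} / I(ℓ)! x^{I(ℓ)} ∂/∂x_ℓ`, for generators `i`. -/
def genField (i : Fin n) : PolyVectorField n :=
  MvPolynomial.mkDerivation ℝ fun l =>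
    if H.head l = i then
      MvPolynomial.monomial (H.multiIndex l) (signedInvFactorial (H.multiIndex l))
    else 0

/-- The Hall-Grayson-Grossman basis `X₁, …, Xₙ` of vector fields in `ℝⁿ`: the first `r` are the
Grayson-Grossman vector fields, the others are the commutators prescribed by the Hall basis.
They are the left-invariant frame of the free nilpotent Lie group of rank `r` and step `s`, in the
exponential coordinates of the second type that they induce. -/
def field (i : Fin n) : PolyVectorField n :=
  match _h : H.factors i with
  | none => H.genField i
  | some p => ⁅field p.1, field p.2⁆
termination_by i
decreasing_by
  · exact H.left_lt _h
  · exact H.right_lt _h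

/-- The layers of the stratified Lie algebra: `layer k` is `𝔤_{k+1}`, where
`𝔤₁ = span {X₁, …, X_r}` and `𝔤_{k+1} = [𝔤₁, 𝔤_k]`. -/
def layer : ℕ → Submodule ℝ (PolyVectorField n)
  | 0 => Submodule.span ℝ (range fun j : Fin r => H.field (H.gen j))
  | k + 1 => Submodule.span ℝ
      {Z | ∃ Y ∈ Submodule.span ℝ (range fun j : Fin r => H.field (H.gen j)),
        ∃ W ∈ layer k, Z = ⁅Y, W⁆}

/-- `r_k = dim 𝔤_k`, for `k ≥ 1`. -/
def layerDim (k : ℕ) : ℕ := Module.finrank ℝ (H.layer (k - 1))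

/-- The generalized structure constants `c^k_{iα}`: `[X_i, X_α] = ∑ₖ c^k_{iα} X_k`. -/
def structConst (i : Fin n) (a : Fin n →₀ ℕ) (k : Fin n) : ℝ :=
  coordinates H.field (iterBracket H.field (H.field i) a) k

/-- `φ_{iα}(v) = (-1)^{|α|} / α! ∑ₖ c^k_{iα} v_k`. -/
def phi (i : Fin n) (a : Fin n →₀ ℕ) (v : Fin n → ℝ) : ℝ :=
  signedInvFactorial a * ∑ k, H.structConst i a k * v k

/-- The extremal polynomial `P_i^v(x) = ∑_α φ_{iα}(v) x^α`; the sum has finitely many nonzero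
terms. -/
def extremalPoly (v : Fin n → ℝ) (i : Fin n) : MvPolynomial (Fin n) ℝ :=
  ∑ᶠ a : Fin n →₀ ℕ, MvPolynomial.monomial a (H.phi i a v)

/-- The set `G_v` of the common zeros of `P_i^v`, `i = 1, …, r₁ + r₂`; it is called a Goh variety
when `v ≠ 0`. -/
def gohVariety (v : Fin n → ℝ) : Set (Fin n → ℝ) :=
  {x | ∀ i : Fin n, (i : ℕ) < H.layerDim 1 + H.layerDim 2 →
    MvPolynomial.eval x (H.extremalPoly v i) = 0}

/-- `h ∈ L^∞([0,1]; ℝʳ)` is a vector of controls of the curve `g`: `ġ = ∑_j h_j X_j(g)` almost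
everywhere on `[0,1]`. -/
def IsControl (g : ℝ → Fin n → ℝ) (h : ℝ → Fin r → ℝ) : Prop :=
  MemLp h ⊤ (volume.restrict (Icc (0 : ℝ) 1)) ∧
  ∀ᵐ t ∂(volume.restrict (Icc (0 : ℝ) 1)),
    HasDerivAt g (∑ j : Fin r, h t j • (H.field (H.gen j)).at (g t)) t

/-- The curve `g : [0,1] → ℝⁿ` is Lipschitz and horizontal. -/
def IsHorizontal (g : ℝ → Fin n → ℝ) : Prop :=
  (∃ K, LipschitzOnWith K g (Icc 0 1)) ∧ ∃ h, H.IsControl g h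

/-- `ξ` solves the adjoint equations along the curve `g` with controls `h`:
`ξ̇_k = - ∑_j ∑_i (∂X_{ji}/∂x_k)(g) h_j ξ_i` almost everywhere on `[0,1]`. -/
def SolvesAdjoint (g : ℝ → Fin n → ℝ) (h : ℝ → Fin r → ℝ) (ξ : ℝ → Fin n → ℝ) : Prop :=
  ∀ᵐ t ∂(volume.restrict (Icc (0 : ℝ) 1)),
    HasDerivAt ξ (fun k => -∑ j : Fin r, ∑ i : Fin n,
      MvPolynomial.eval (g t)
        (MvPolynomial.pderiv k (PolyVectorField.coeff (H.field (H.gen j)) i)) * h t j * ξ t i) t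

/-- The curve `g` is a Goh extremal: it is horizontal and has a nowhere vanishing Lipschitz dual
curve `ξ` that solves the adjoint equations and annihilates all `X_i` and `[X_i, X_j]`,
`i, j = 1, …, r`, along `g`. -/
def IsGohExtremal (g : ℝ → Fin n → ℝ) : Prop :=
  (∃ K, LipschitzOnWith K g (Icc 0 1)) ∧ ∃ h, H.IsControl g h ∧
  ∃ ξ : ℝ → Fin n → ℝ, (∃ K, LipschitzOnWith K ξ (Icc 0 1)) ∧
    (∀ t ∈ Icc (0 : ℝ) 1, ξ t ≠ 0) ∧
    H.SolvesAdjoint g h ξ ∧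
    ∀ t ∈ Icc (0 : ℝ) 1,
      (∀ i : Fin r, ξ t ⬝ᵥ (H.field (H.gen i)).at (g t) = 0) ∧
      ∀ i j : Fin r, ξ t ⬝ᵥ (⁅H.field (H.gen i), H.field (H.gen j)⁆).at (g t) = 0

end HallBasis

end

/-! Write [X_j, X_i] = ∑_k c_{ji}^k X_k. Along a horizontal curve γ with controls h, the pairings
u_i = ⟨ξ, X_i(γ)⟩ with an adjoint curve satisfy the linear system u_i' = ∑_k (∑_j h_j c_{ji}^k) u_k
almost everywhere (`hasDerivAt_pairing`). The functions P_i^v(γ) satisfy the same system, because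
X_j P_i^v = ∑_k c_{ji}^k P_k^v for every generator X_j (`field_extremalPoly`). At the origin X_i(0)
= ∂/∂x_i (`eval_zero_field`) and P_i^v(0) = v_i, so for v = ξ(0) uniqueness
(`eq_zero_of_linear_ode`) gives ⟨ξ, X_i(γ)⟩ = P_i^v(γ). The first r₁ + r₂ Hall elements are those of
degree at most 2 (`lt_layerDim_add_iff`), so the annihilation conditions are the vanishing of these
P_i^v.

Conversely, the frame is unitriangular (`det_frame`), so for each v there is a polynomial covector
field with components P_i^v in the dual frame (`dualPoly`). Restricted to γ it solves the adjoint
equations (`field_dualPoly`) and never vanishes when v ≠ 0 (`eq_zero_of_eval_extremalPoly`).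

The heart is the formula for X_j P_i^v. One has P_i^v(x) = ⟨v, Φ X_i⟩ with the automorphism Φ =
e^{x_n ad X_n} ⋯ e^{x_1 ad X_1} (`eval_extremalPoly`). If Φ_l denotes its part up to the l-th
factor, then ∂P_i^v/∂x_l = ⟨v, Φ[Φ_l⁻¹ X_l, X_i]⟩, and the formula reduces to ∑_l (X_j)_l Φ_l⁻¹ X_l
= X_j (`sum_gradedCoeff_symm`). This is proved by eliminating the Hall elements one at a time:
e^{x_m ad X_m} generates all brackets with copies of X_m, with exactly the coefficients of the
Grayson-Grossman fields.

Underneath lie three facts about the fields: they are independent, homogeneous under dilations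
(`euler_lie_field`), and their span is closed under brackets (`lie_field_field_mem`). -/

noncomputable section

/-! ### Combinatorics of Hall elements and their multi-indices. -/

namespace HallBasis

variable {r s n : ℕ} (H : HallBasis r s n)

theorem head_of_none {l : Fin n} (h : H.factors l = none) : H.head l = l := by
  rw [head]; split
  · rfl
  · simp_all

theorem head_of_some {l : Fin n} {p : Fin n × Fin n} (h : H.factors l = some p) :
    H.head l = H.head p.1 := by
  rw [head]; split
  · simp_all
  · simp_all

theorem multiIndex_of_none {l : Fin n} (h : H.factors l = none) : H.multiIndex l = 0 := by
  rw [multiIndex]; split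
  · rfl
  · simp_all

theorem multiIndex_of_some {l : Fin n} {p : Fin n × Fin n} (h : H.factors l = some p) :
    H.multiIndex l = H.multiIndex p.1 + Finsupp.single p.2 1 := by
  rw [multiIndex]; split
  · simp_all
  · simp_all

theorem field_of_none {l : Fin n} (h : H.factors l = none) : H.field l = H.genField l := by
  rw [field]; split
  · rfl
  · simp_all

theorem field_of_some {l : Fin n} {p : Fin n × Fin n} (h : H.factors l = some p) :
    H.field l = ⁅H.field p.1, H.field p.2⁆ := by
  rw [field]; split
  · simp_all
  · simp_all

theorem factors_gen (j : Fin r) : H.factors (H.gen j) = none := by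
  rw [H.factors_eq_none_iff]; simp [gen]

/-- Hall's condition on consecutive right factors iterates to ℓ₁ ≤ ℓ₂ ≤ ⋯ ≤ ℓ_h. -/
theorem le_right_of_multiIndex_left_ne_zero {l : Fin n} {p : Fin n × Fin n}
    (h : H.factors l = some p) {q : Fin n} (hq : H.multiIndex p.1 q ≠ 0) : q ≤ p.2 := by
  induction l using WellFoundedLT.induction generalizing p with
  | ind l ih =>
  rcases h1 : H.factors p.1 with _ | p'
  · simp [H.multiIndex_of_none h1] at hq
  · have h2 := ((H.exists_factors_iff p.1 p.2).1 ⟨l, h⟩).2.2 _ _ h1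
    rw [H.multiIndex_of_some h1, Finsupp.add_apply] at hq
    by_cases h3 : H.multiIndex p'.1 q = 0
    · have : q = p'.2 := by
        by_contra hne
        rw [h3, Finsupp.single_eq_of_ne hne] at hq
        exact hq rfl
      exact this ▸ h2
    · exact (ih _ (H.left_lt h) h1 h3).trans h2

theorem le_right_of_multiIndex_ne_zero {l : Fin n} {p : Fin n × Fin n}
    (h : H.factors l = some p) {q : Fin n} (hq : H.multiIndex l q ≠ 0) : q ≤ p.2 := by
  rw [H.multiIndex_of_some h, Finsupp.add_apply] at hq
  by_cases h3 : H.multiIndex p.1 q = 0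
  · by_contra hne
    rw [h3, Finsupp.single_eq_of_ne (by rintro rfl; exact hne le_rfl)] at hq
    exact hq rfl
  · exact H.le_right_of_multiIndex_left_ne_zero h h3

theorem multiIndex_right_ne_zero {l : Fin n} {p : Fin n × Fin n}
    (h : H.factors l = some p) : H.multiIndex l p.2 ≠ 0 := by
  simp [H.multiIndex_of_some h]

theorem lt_of_multiIndex_ne_zero {l q : Fin n} (hq : H.multiIndex l q ≠ 0) : q < l := by
  rcases h : H.factors l with _ | p
  · simp [H.multiIndex_of_none h] at hq
  · exact (H.le_right_of_multiIndex_ne_zero h hq).trans_lt (H.right_lt h)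

/-- A Hall element is determined by its head and its multi-index. -/
theorem eq_of_head_of_multiIndex {l l' : Fin n} (h : H.head l = H.head l')
    (hI : H.multiIndex l = H.multiIndex l') : l = l' := by
  induction l using WellFoundedLT.induction generalizing l' with
  | ind l ih =>
  rcases h1 : H.factors l with _ | p <;> rcases h2 : H.factors l' with _ | p'
  · rwa [H.head_of_none h1, H.head_of_none h2] at h
  · exact absurd (hI ▸ H.multiIndex_of_none h1 : H.multiIndex l' = 0)
      fun h0 => H.multiIndex_right_ne_zero h2 (by simp [h0])
  · exact absurd (hI ▸ H.multiIndex_of_none h2 : H.multiIndex l = 0)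
      fun h0 => H.multiIndex_right_ne_zero h1 (by simp [h0])
  -- The outermost right factor is the largest index in the support of the multi-index, so both
  -- elements share it and it can be peeled off.
  · have e2 : p.2 = p'.2 := le_antisymm
      (H.le_right_of_multiIndex_ne_zero h2 (hI ▸ H.multiIndex_right_ne_zero h1))
      (H.le_right_of_multiIndex_ne_zero h1 (hI ▸ H.multiIndex_right_ne_zero h2))
    have e1 : p.1 = p'.1 := by
      apply ih _ (H.left_lt h1)
      · rwa [H.head_of_some h1, H.head_of_some h2] at h
      · rw [H.multiIndex_of_some h1, H.multiIndex_of_some h2, e2] at hI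
        exact add_right_cancel hI
    exact H.factors_inj _ _ p h1 (by rw [h2, Prod.ext e1 e2])

/-- Removing the outer right factors that are `≥ j`. -/
theorem exists_strip (j m : Fin n) : ∃ m', H.head m' = H.head m ∧
    (∀ i, H.multiIndex m' i = if i < j then H.multiIndex m i else 0) ∧ (m' = m ∨ j < m') := by
  induction m using WellFoundedLT.induction with
  | ind m ih =>
  rcases h : H.factors m with _ | p
  · exact ⟨m, rfl, by simp [H.multiIndex_of_none h], .inl rfl⟩
  · by_cases hj : j ≤ p.2
    · obtain ⟨m', h1, h2, h3⟩ := ih _ (H.left_lt h)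
      refine ⟨m', by rw [h1, H.head_of_some h], fun i => ?_, .inr ?_⟩
      · rw [h2, H.multiIndex_of_some h, Finsupp.add_apply]
        split_ifs with hi
        · rw [Finsupp.single_eq_of_ne (hi.trans_le hj).ne, add_zero]
        · rfl
      · rcases h3 with rfl | h3
        · exact hj.trans_lt ((H.exists_factors_iff _ _).1 ⟨m, h⟩).2.1
        · exact h3
    · refine ⟨m, rfl, fun i => ?_, .inl rfl⟩
      split_ifs with hi
      · rfl
      · by_contra h0
        exact hi ((H.le_right_of_multiIndex_ne_zero h h0).trans_lt (not_le.1 hj))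

/-- The only Hall element that arises from `X_j` by bracketing with elements `≥ j` is `X_j`. -/
theorem eq_of_head_of_multiIndex_lt {j m : Fin n} (h : H.head m = H.head j)
    (hI : ∀ i < j, H.multiIndex m i = H.multiIndex j i) : m = j := by
  obtain ⟨m', h1, h2, h3⟩ := H.exists_strip j m
  have : m' = j := by
    apply H.eq_of_head_of_multiIndex (h1.trans h)
    ext i
    rw [h2]
    split_ifs with hi
    · exact hI i hi
    · by_contra h0
      exact hi (H.lt_of_multiIndex_ne_zero (Ne.symm h0))
  -- The stripped element is X_j; had anything been removed, it would come strictly after X_j.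
  rcases h3 with h3 | h3
  · exact h3.symm.trans this
  · exact absurd this h3.ne'

theorem exists_factors_eq_some {p j : Fin n} (hj : j < p)
    (hI : ∀ q, H.multiIndex p q ≠ 0 → q ≤ j) (hd : H.deg p + H.deg j ≤ s) :
    ∃ i, H.factors i = some (p, j) :=
  (H.exists_factors_iff p j).2 ⟨hd, hj, fun _ _ h => hI _ (H.multiIndex_right_ne_zero h)⟩

theorem deg_mono {i j : Fin n} (h : i ≤ j) : H.deg i ≤ H.deg j := by
  by_contra h0
  exact absurd (H.lt_of_deg_lt _ _ (not_le.1 h0)) (not_lt.2 h)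

/-- If the largest right factor of `X_l` is at most `j` and `X_j` occurs among the right factors,
then `X_l = [X_p, X_j]`. -/
theorem exists_left_of_multiIndex_ne_zero {l j : Fin n} (hI : ∀ q, H.multiIndex l q ≠ 0 → q ≤ j)
    (hj : H.multiIndex l j ≠ 0) : ∃ p, H.factors l = some (p, j) := by
  rcases h : H.factors l with _ | p
  · simp [H.multiIndex_of_none h] at hj
  · exact ⟨p.1, by rw [le_antisymm (H.le_right_of_multiIndex_ne_zero h hj)
      (hI _ (H.multiIndex_right_ne_zero h))]⟩

end HallBasis

/-! ### Divided powers and restriction to coordinate subspaces. -/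

namespace MvPolynomial

variable {σ : Type*}

/-- Two derivations that are intertwined by an algebra endomorphism on the variables are
intertwined by it. -/
theorem derivation_intertwine (φ : MvPolynomial σ ℝ →ₐ[ℝ] MvPolynomial σ ℝ)
    (Z Y : Derivation ℝ (MvPolynomial σ ℝ) (MvPolynomial σ ℝ))
    (h : ∀ m, φ (Z (X m)) = Y (φ (X m))) (f : MvPolynomial σ ℝ) : φ (Z f) = Y (φ f) := by
  induction f using MvPolynomial.induction_on with
  | C a => 
    have : φ (C a) = C a := φ.commutes a
    simp [this]
  | add p q hp hq => simp [hp, hq]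
  | mul_X p i hp =>
    simp only [Derivation.leibniz, smul_eq_mul, map_add, map_mul, hp, h]

/-- The divided power `(-x_i)^{a-k} / (a-k)!`, which is `0` for `a < k`. -/
def negDividedPow (i : σ) (a k : ℕ) : MvPolynomial σ ℝ :=
  if k ≤ a then C (((a - k).factorial : ℝ)⁻¹) * (-X i) ^ (a - k) else 0

/-- Keeping a and k apart, with the value 0 for k > a, makes the rule hold at k = a too, where
truncated subtraction would give 1 instead of 0. -/
theorem pderiv_negDividedPow (i : σ) (a k : ℕ) :
    pderiv i (negDividedPow i a k) = -negDividedPow i a (k + 1) := by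
  unfold negDividedPow
  rcases lt_trichotomy a k with h | rfl | h
  · simp [show ¬ k ≤ a by omega, show ¬ k + 1 ≤ a by omega]
  · simp
  · obtain ⟨b, rfl⟩ := Nat.exists_eq_add_of_lt h
    have e1 : k + b + 1 - k = b + 1 := by omega
    have e2 : k + b + 1 - (k + 1) = b := by omega
    rw [if_pos (by omega), if_pos (by omega), e1, e2, pderiv_C_mul, pderiv_pow]
    simp only [map_neg, pderiv_X_self, add_tsub_cancel_right, Nat.factorial_succ]
    have hb : C (((b + 1 : ℕ) * b.factorial : ℕ) : ℝ)⁻¹ * ((b + 1 : ℕ) : MvPolynomial σ ℝ)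
        = C ((b.factorial : ℝ)⁻¹) := by
      rw [← map_natCast C, ← C_mul]
      congr 1
      have : (b.factorial : ℝ) ≠ 0 := by positivity
      push_cast
      field_simp
    rw [← hb]
    ring

theorem pderiv_negDividedPow_of_ne {i j : σ} (h : j ≠ i) (a k : ℕ) :
    pderiv i (negDividedPow j a k) = 0 := by
  unfold negDividedPow
  split_ifs
  · rw [pderiv_C_mul, pderiv_pow, map_neg, pderiv_X_of_ne h]; simp
  · simp

theorem map_negDividedPow (φ : MvPolynomial σ ℝ →ₐ[ℝ] MvPolynomial σ ℝ) {i : σ}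
    (h : φ (X i) = X i) (a k : ℕ) : φ (negDividedPow i a k) = negDividedPow i a k := by
  unfold negDividedPow
  have (c : ℝ) : φ (C c) = C c := φ.commutes c
  split_ifs <;> simp [h, this]

theorem map_negDividedPow_of_eq_zero {A : Type*} [CommRing A] [Algebra ℝ A]
    (φ : MvPolynomial σ ℝ →ₐ[ℝ] A) {i : σ}
    (h : φ (X i) = 0) (a k : ℕ) : φ (negDividedPow i a k) = if a = k then 1 else 0 := by
  unfold negDividedPow
  have (c : ℝ) : φ (C c) = algebraMap ℝ A c := φ.commutes c
  rcases lt_trichotomy a k with h1 | rfl | h1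
  · simp [show ¬ k ≤ a by omega, h1.ne]
  · simp
  · simp [h1.le, h1.ne', h, show a - k ≠ 0 by omega]

end MvPolynomial

open MvPolynomial

/-- The product of the divided powers `(-x_i)^{a_i} / a_i!` over `i ≥ j`. -/
def tailMonomial {n : ℕ} (j : ℕ) (a : Fin n →₀ ℕ) : MvPolynomial (Fin n) ℝ :=
  ∏ i ∈ Finset.univ.filter fun i : Fin n => j ≤ (i : ℕ), negDividedPow i (a i) 0

/-- The substitution `x_i = 0` for `i < j`. -/
def killBelow (n j : ℕ) : MvPolynomial (Fin n) ℝ →ₐ[ℝ] MvPolynomial (Fin n) ℝ :=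
  aeval fun i => if (i : ℕ) < j then 0 else X i

section

variable {n : ℕ}

theorem killBelow_X_of_lt {j : ℕ} {i : Fin n} (h : (i : ℕ) < j) : killBelow n j (X i) = 0 := by
  simp [killBelow, h]

theorem killBelow_X_of_le {j : ℕ} {i : Fin n} (h : j ≤ (i : ℕ)) : killBelow n j (X i) = X i := by
  simp [killBelow, h]

theorem killBelow_zero (f : MvPolynomial (Fin n) ℝ) : killBelow n 0 f = f := by
  simp [killBelow]

theorem killBelow_succ_killBelow (j : ℕ) (f : MvPolynomial (Fin n) ℝ) :
    killBelow n (j + 1) (killBelow n j f) = killBelow n (j + 1) f := by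
  have : (killBelow n (j + 1)).comp (killBelow n j) = killBelow n (j + 1) := by
    apply MvPolynomial.algHom_ext
    intro i
    by_cases h : (i : ℕ) < j
    · simp [killBelow_X_of_lt h, killBelow_X_of_lt (h.trans (Nat.lt_succ_self j))]
    · simp [killBelow_X_of_le (not_lt.1 h)]
  exact DFunLike.congr_fun this f

theorem tailMonomial_eq (j : Fin n) (a : Fin n →₀ ℕ) :
    tailMonomial j a = negDividedPow j (a j) 0 * tailMonomial (j + 1) a := by
  have : (Finset.univ.filter fun i : Fin n => (j : ℕ) ≤ (i : ℕ)) =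
      insert j (Finset.univ.filter fun i : Fin n => (j : ℕ) + 1 ≤ (i : ℕ)) := by
    ext i
    simp only [Finset.mem_filter, Finset.mem_univ, true_and, Finset.mem_insert, Fin.ext_iff]
    omega
  rw [tailMonomial, this, Finset.prod_insert (by simp)]
  rfl

theorem pderiv_tailMonomial (j : Fin n) (a : Fin n →₀ ℕ) :
    pderiv j (tailMonomial (j + 1) a) = 0 := by
  refine Finset.prod_induction _ (fun f => pderiv j f = 0) (fun f g hf hg => ?_) (by simp) ?_
  · simp [hf, hg]
  · intro i hi
    apply pderiv_negDividedPow_of_ne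
    rintro rfl
    simp at hi

theorem killBelow_tailMonomial (j : ℕ) (a : Fin n →₀ ℕ) :
    killBelow n j (tailMonomial j a) = tailMonomial j a := by
  rw [tailMonomial, map_prod]
  refine Finset.prod_congr rfl fun i hi => map_negDividedPow _ (killBelow_X_of_le ?_) _ _
  simpa using hi

theorem tailMonomial_zero (a : Fin n →₀ ℕ) :
    tailMonomial 0 a = monomial a (signedInvFactorial a) := by
  rw [monomial_eq, Finsupp.prod_fintype _ _ (by simp), tailMonomial]
  simp only [negDividedPow, zero_le, if_true, tsub_zero, Finset.filter_true]
  have h (i : Fin n) : (C ((a i).factorial : ℝ)⁻¹ : MvPolynomial (Fin n) ℝ) * (-X i) ^ a i =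
      C ((-1) ^ a i * ((a i).factorial : ℝ)⁻¹) * X i ^ a i := by
    rw [neg_pow, C_mul, C_pow, C_neg, C_1]; ring
  simp only [h, Finset.prod_mul_distrib]
  rw [← map_prod, Finset.prod_mul_distrib, Finset.prod_pow_eq_pow_sum, signedInvFactorial,
    multiFactorial, Finsupp.degree_eq_sum, Nat.cast_prod, Finset.prod_inv_distrib, div_eq_mul_inv]

end

/-! ### The fields at the origin, by successive restriction. -/

namespace HallBasis

variable {r s n : ℕ} (H : HallBasis r s n)

/-- Restriction of `X_p` to the subspace `x_0 = ⋯ = x_{j-1} = 0`, for the elements `X_p` that are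
not brackets with an element `≥ j`. -/
def RestrictsAt (j : ℕ) : Prop :=
  ∀ p : Fin n, j ≤ (p : ℕ) → (∀ q, H.multiIndex p q ≠ 0 → (q : ℕ) < j) → ∀ m : Fin n,
    killBelow n j (H.field p (X m)) =
      if H.head m = H.head p ∧ ∀ i : Fin n, (i : ℕ) < j → H.multiIndex m i = H.multiIndex p i
      then tailMonomial j (H.multiIndex m) else 0

theorem restrictsAt_zero : H.RestrictsAt 0 := by
  intro p _ hp m
  have h0 : H.factors p = none := by
    rcases h : H.factors p with _ | q
    · rfl
    · exact absurd (hp _ (H.multiIndex_right_ne_zero h)) (Nat.not_lt_zero _)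
  rw [killBelow_zero, H.field_of_none h0, genField, mkDerivation_X, H.head_of_none h0,
    tailMonomial_zero]
  simp

/-- On x_0 = ⋯ = x_{j-1} = 0 only the coefficient of ∂/∂x_j survives
(`eq_of_head_of_multiIndex_lt`), and it equals 1 because I(j) is supported below j. Bracketing with
X_j thus becomes differentiation in x_j. -/
theorem killBelow_field_self {j : Fin n} (hj : H.RestrictsAt j) (f : MvPolynomial (Fin n) ℝ) :
    killBelow n j (H.field j f) = pderiv j (killBelow n j f) := by
  refine derivation_intertwine _ _ _ (fun m => ?_) f
  rw [hj j le_rfl (fun q hq => H.lt_of_multiIndex_ne_zero hq) m]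
  have hiff : (H.head m = H.head j ∧
      ∀ i : Fin n, (i : ℕ) < j → H.multiIndex m i = H.multiIndex j i) ↔ m = j :=
    ⟨fun h => H.eq_of_head_of_multiIndex_lt h.1 h.2, fun h => by simp [h]⟩
  by_cases hm : m = j
  · subst hm
    rw [if_pos (hiff.2 rfl), killBelow_X_of_le le_rfl, pderiv_X_self, tailMonomial]
    refine Finset.prod_eq_one fun i hi => ?_
    have : H.multiIndex m i = 0 := by
      by_contra h0
      have h1 := H.lt_of_multiIndex_ne_zero h0
      have h2 : (m : ℕ) ≤ i := by simpa using hi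
      exact absurd h1 (not_lt.2 h2)
    simp [this, negDividedPow]
  · rw [if_neg (mt hiff.1 hm)]
    by_cases h : (m : ℕ) < j
    · simp [killBelow_X_of_lt h]
    · rw [killBelow_X_of_le (not_lt.1 h), pderiv_X_of_ne hm]

/-- For X_p = [X_{p'}, X_j] both factors are tangent to the subspace, so the restricted bracket is
[X_{p'}, ∂/∂x_j]. Its coefficients are minus the x_j-derivatives of those of X_{p'}, and this sign
cancels the one from the divided power. -/
theorem killBelow_field_of_lt {j : Fin n} (hj : H.RestrictsAt j) {p : Fin n} (hp : j < p)
    (hI : ∀ q, H.multiIndex p q ≠ 0 → q ≤ j) (m : Fin n) :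
    killBelow n j (H.field p (X m)) =
      if H.head m = H.head p ∧ ∀ i < j, H.multiIndex m i = H.multiIndex p i
      then negDividedPow j (H.multiIndex m j) (H.multiIndex p j) *
        tailMonomial (j + 1) (H.multiIndex m) else 0 := by
  induction p using WellFoundedLT.induction generalizing m with
  | ind p ih =>
  by_cases h0 : H.multiIndex p j = 0
  · rw [hj p hp.le (fun q hq => lt_of_le_of_ne (hI q hq) (fun h => hq (by
      rw [← h0]; congr 1; exact Fin.ext h))) m, h0, tailMonomial_eq]
    rfl
  · obtain ⟨p', hp'⟩ := H.exists_left_of_multiIndex_ne_zero hI h0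
    have hjp' : j < p' := ((H.exists_factors_iff _ _).1 ⟨p, hp'⟩).2.1
    have hI' : ∀ q, H.multiIndex p' q ≠ 0 → q ≤ j :=
      fun q hq => H.le_right_of_multiIndex_left_ne_zero hp' hq
    have ih' := ih p' (H.left_lt hp') hjp' hI'
    -- Tangency of X_{p'}: for m < j the restricted coefficient of ∂/∂x_m is zero, since otherwise
    -- either m = p' or the divided power has k > a.
    have htan : ∀ f, killBelow n j (H.field p' f) =
        mkDerivation ℝ (fun m => killBelow n j (H.field p' (X m))) (killBelow n j f) := by
      refine derivation_intertwine _ _ _ fun m => ?_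
      by_cases h : (m : ℕ) < j
      · rw [killBelow_X_of_lt h, map_zero, ih']
        split_ifs with hc
        · have hmj : H.multiIndex m j = 0 := by
            by_contra h2
            exact absurd (H.lt_of_multiIndex_ne_zero h2) (not_lt.2 (le_of_lt h))
          by_cases h3 : H.multiIndex p' j = 0
          · exfalso
            have : m = p' := by
              apply H.eq_of_head_of_multiIndex hc.1
              ext i
              rcases lt_trichotomy i j with hi | rfl | hi
              · exact hc.2 i hi
              · rw [hmj, h3]
              · have a1 : H.multiIndex m i = 0 := by
                  by_contra h4
                  exact absurd (H.lt_of_multiIndex_ne_zero h4) (not_lt.2 (le_of_lt (lt_trans h hi)))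
                have a2 : H.multiIndex p' i = 0 := by
                  by_contra h4
                  exact absurd (hI' _ h4) (not_le.2 hi)
                rw [a1, a2]
            subst this
            exact absurd hjp' (not_lt.2 (le_of_lt h))
          · rw [negDividedPow, if_neg (by omega), zero_mul]
        · rfl
      · rw [killBelow_X_of_le (not_lt.1 h), mkDerivation_X]
    have hself : killBelow n j (H.field j (X m)) = if m = j then 1 else 0 := by
      rw [H.killBelow_field_self hj]
      by_cases h : (m : ℕ) < j
      · rw [killBelow_X_of_lt h, if_neg (by rintro rfl; exact lt_irrefl _ h), map_zero]
      · rw [killBelow_X_of_le (not_lt.1 h), pderiv_X, Pi.single_apply]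
    rw [H.field_of_some hp', Derivation.commutator_apply, map_sub, htan, hself,
      H.killBelow_field_self hj, ih']
    have e1 : (mkDerivation ℝ fun m => killBelow n j (H.field p' (X m)))
        (if m = j then 1 else 0) = 0 := by split_ifs <;> simp
    have e2 : H.multiIndex p j = H.multiIndex p' j + 1 := by
      simp [H.multiIndex_of_some hp']
    have e3 : (H.head m = H.head p' ∧ ∀ i < j, H.multiIndex m i = H.multiIndex p' i) ↔
        (H.head m = H.head p ∧ ∀ i < j, H.multiIndex m i = H.multiIndex p i) := by
      rw [H.head_of_some hp']
      refine and_congr Iff.rfl (forall₂_congr fun i hi => ?_)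
      rw [H.multiIndex_of_some hp', Finsupp.add_apply, Finsupp.single_eq_of_ne hi.ne, add_zero]
    rw [e1, zero_sub, e2]
    simp only [e3]
    split_ifs
    · rw [pderiv_mul, pderiv_negDividedPow, pderiv_tailMonomial]
      ring
    · simp

theorem RestrictsAt.succ {H : HallBasis r s n} {j : Fin n} (hj : H.RestrictsAt j) :
    H.RestrictsAt (j + 1) := by
  intro p hp hI m
  rw [← killBelow_succ_killBelow, H.killBelow_field_of_lt hj (Nat.lt_of_succ_le hp)
    (fun q hq => Nat.le_of_lt_succ (hI q hq))]
  have hiff : (H.head m = H.head p ∧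
      ∀ i : Fin n, (i : ℕ) < j + 1 → H.multiIndex m i = H.multiIndex p i) ↔
      (H.head m = H.head p ∧ ∀ i < j, H.multiIndex m i = H.multiIndex p i) ∧
        H.multiIndex m j = H.multiIndex p j := by
    constructor
    · exact fun h => ⟨⟨h.1, fun i hi => h.2 i (Nat.lt_succ_of_lt hi)⟩, h.2 j (Nat.lt_succ_self _)⟩
    · rintro ⟨⟨h1, h2⟩, h3⟩
      refine ⟨h1, fun i hi => ?_⟩
      rcases Nat.lt_succ_iff_lt_or_eq.1 hi with h | h
      · exact h2 i h
      · rwa [Fin.ext h]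
  by_cases h1 : H.head m = H.head p ∧ ∀ i < j, H.multiIndex m i = H.multiIndex p i
  -- Setting x_j = 0 keeps only the terms whose divided power is exhausted, that is, I(m)_j =
  -- I(p)_j.
  · rw [if_pos h1, map_mul, map_negDividedPow_of_eq_zero _ (killBelow_X_of_lt (Nat.lt_succ_self _)),
      killBelow_tailMonomial]
    by_cases h2 : H.multiIndex m j = H.multiIndex p j
    · rw [if_pos h2, if_pos (hiff.2 ⟨h1, h2⟩), one_mul]
    · rw [if_neg h2, if_neg (fun h => h2 (hiff.1 h).2), zero_mul]
  · rw [if_neg h1, if_neg (fun h => h1 (hiff.1 h).1), map_zero]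

theorem restrictsAt (j : ℕ) (hj : j ≤ n) : H.RestrictsAt j := by
  induction j with
  | zero => exact H.restrictsAt_zero
  | succ j ih => exact RestrictsAt.succ (j := ⟨j, hj⟩) (ih (Nat.le_of_succ_le hj))

/-- The theorem of Grayson and Grossman: `X_p(0) = ∂/∂x_p`. -/
theorem eval_zero_field (p m : Fin n) :
    eval 0 (H.field p (X m)) = if m = p then 1 else 0 := by
  have h1 (f : MvPolynomial (Fin n) ℝ) : eval 0 f = eval 0 (killBelow n p f) := by
    have : (aeval (0 : Fin n → ℝ) : _ →ₐ[ℝ] ℝ) =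
        (aeval (0 : Fin n → ℝ) : _ →ₐ[ℝ] ℝ).comp (killBelow n p) := by
      apply MvPolynomial.algHom_ext
      intro i
      by_cases h : (i : ℕ) < p
      · simp [killBelow_X_of_lt h]
      · simp [killBelow_X_of_le (not_lt.1 h)]
    exact DFunLike.congr_fun this f
  have hp := H.restrictsAt p p.2.le
  rw [h1, H.killBelow_field_self hp]
  by_cases h : (m : ℕ) < p
  · rw [killBelow_X_of_lt h, if_neg (by rintro rfl; exact lt_irrefl _ h), map_zero, map_zero]
  · rw [killBelow_X_of_le (not_lt.1 h), pderiv_X, Pi.single_apply]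
    by_cases hm : m = p
    · simp [hm]
    · simp [hm]

theorem field_at_zero (p : Fin n) : (H.field p).at 0 = Pi.single p 1 := by
  ext m
  rw [PolyVectorField.at, PolyVectorField.coeff, H.eval_zero_field, Pi.single_apply]

/-- Evaluation of vector fields at a point. -/
def evalField (x : Fin n → ℝ) : PolyVectorField n →ₗ[ℝ] Fin n → ℝ where
  toFun Y := Y.at x
  map_add' Y Z := by ext; simp [PolyVectorField.at, PolyVectorField.coeff]
  map_smul' c Y := by ext; simp [PolyVectorField.at, PolyVectorField.coeff, smul_eval]

theorem linearIndependent_field : LinearIndependent ℝ H.field := by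
  apply LinearIndependent.of_comp (evalField 0)
  have : evalField 0 ∘ H.field = fun p => Pi.single p (1 : ℝ) := funext H.field_at_zero
  rw [this]
  exact Pi.linearIndependent_single_one (Fin n) ℝ

end HallBasis

/-! ### Bracket identities for vector fields. -/

namespace PolyVectorField

variable {n : ℕ} (Y Z W : PolyVectorField n) (c : ℝ)

theorem sum_apply {ι : Type*} (t : Finset ι) (F : ι → PolyVectorField n)
    (f : MvPolynomial (Fin n) ℝ) : (∑ i ∈ t, F i) f = ∑ i ∈ t, F i f :=
  map_sum ({ toFun := fun Y : PolyVectorField n => Y f, map_zero' := rfl,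
             map_add' := fun _ _ => rfl } : PolyVectorField n →+ _) F t

theorem zero_lie : ⁅(0 : PolyVectorField n), Z⁆ = 0 := _root_.zero_lie Z
theorem lie_zero : ⁅Z, (0 : PolyVectorField n)⁆ = 0 := _root_.lie_zero Z
theorem add_lie : ⁅Y + Z, W⁆ = ⁅Y, W⁆ + ⁅Z, W⁆ := _root_.add_lie Y Z W
theorem lie_add : ⁅Y, Z + W⁆ = ⁅Y, Z⁆ + ⁅Y, W⁆ := _root_.lie_add Y Z W
theorem smul_lie : ⁅c • Y, Z⁆ = c • ⁅Y, Z⁆ := _root_.smul_lie c Y Z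
theorem lie_smul : ⁅Y, c • Z⁆ = c • ⁅Y, Z⁆ := _root_.lie_smul c Y Z
theorem lie_self : ⁅Y, Y⁆ = 0 := _root_.lie_self Y
theorem neg_lie_swap : ⁅Y, Z⁆ = -⁅Z, Y⁆ := (_root_.lie_skew Y Z).symm
theorem leibniz_lie : ⁅Y, ⁅Z, W⁆⁆ = ⁅⁅Y, Z⁆, W⁆ + ⁅Z, ⁅Y, W⁆⁆ := by
  refine Derivation.ext fun f => ?_
  simp only [Derivation.commutator_apply, Derivation.add_apply, map_sub]
  abel
-- The Jacobi identity with both terms left-normed, the form used in Hall's rewriting.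
theorem lie_lie_eq : ⁅⁅Y, Z⁆, W⁆ = ⁅⁅Y, W⁆, Z⁆ - ⁅⁅Z, W⁆, Y⁆ := by
  refine Derivation.ext fun f => ?_
  simp only [Derivation.commutator_apply, Derivation.sub_apply, map_sub]
  abel

end PolyVectorField

/-! ### Dilation weights, Hall's rewriting and the spanned Lie algebra. -/

namespace HallBasis
open MvPolynomial

variable {r s n : ℕ} (H : HallBasis r s n)

/-- The Euler vector field of the dilations `x_i ↦ λ^{deg i} x_i`. -/
def euler : PolyVectorField n := mkDerivation ℝ fun m => (H.deg m : ℝ) • X m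

theorem euler_monomial (a : Fin n →₀ ℕ) (c : ℝ) :
    H.euler (monomial a c) = (∑ q, (a q : ℝ) * H.deg q) • monomial a c := by
  have h : H.euler = ∑ q, ((H.deg q : ℝ) • X q : MvPolynomial (Fin n) ℝ) • pderiv q := by
    apply derivation_ext
    intro i
    rw [euler, mkDerivation_X, PolyVectorField.sum_apply]
    simp [pderiv_X, Pi.single_apply]
  rw [h, PolyVectorField.sum_apply, Finset.sum_smul]
  refine Finset.sum_congr rfl fun q _ => ?_
  rw [Derivation.smul_apply, smul_eq_mul, smul_mul_assoc, X_mul_pderiv_monomial, mul_comm, mul_smul,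
    ← Nat.cast_smul_eq_nsmul ℝ]

theorem coeff_euler (a : Fin n →₀ ℕ) (f : MvPolynomial (Fin n) ℝ) :
    coeff a (H.euler f) = (∑ q, (a q : ℝ) * H.deg q) * coeff a f := by
  induction f using MvPolynomial.induction_on' with
  | monomial b c =>
    rw [euler_monomial, coeff_smul, smul_eq_mul, coeff_monomial]
    split_ifs with h
    · rw [h]
    · simp
  | add p q hp hq => simp [hp, hq, mul_add]

theorem deg_eq (m : Fin n) : H.deg m = 1 + ∑ q, H.multiIndex m q * H.deg q := by
  induction m using WellFoundedLT.induction with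
  | ind m ih =>
  rcases h : H.factors m with _ | p
  · simp [H.multiIndex_of_none h, H.deg_gen m h]
  · rw [H.deg_bracket m p.1 p.2 h, ih _ (H.left_lt h), H.multiIndex_of_some h]
    simp [add_mul, Finset.sum_add_distrib, Finsupp.single_apply, add_assoc]

/-- By `deg_eq` the monomial x^{I(m)} has weight deg m - 1, so x^{I(m)} ∂/∂x_m has weight -1 for
every m; weights add under brackets. -/
theorem euler_lie_field (i : Fin n) : ⁅H.euler, H.field i⁆ = -(H.deg i : ℝ) • H.field i := by
  induction i using WellFoundedLT.induction with
  | ind i ih =>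
  rcases h : H.factors i with _ | p
  · rw [H.field_of_none h, H.deg_gen i h]
    apply derivation_ext
    intro m
    have e1 : H.euler (X m) = (H.deg m : ℝ) • X m := mkDerivation_X ..
    rw [Derivation.commutator_apply, Derivation.smul_apply, e1, Derivation.map_smul, genField,
      mkDerivation_X]
    split_ifs
    · rw [euler_monomial, ← sub_smul]
      congr 1
      rw [H.deg_eq m]
      push_cast
      ring
    · simp
  · rw [H.field_of_some h, PolyVectorField.leibniz_lie, ih _ (H.left_lt h), ih _ (H.right_lt h),
      H.deg_bracket i p.1 p.2 h, PolyVectorField.smul_lie, PolyVectorField.lie_smul, ← add_smul]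
    congr 1
    push_cast
    ring

/-- Comparing coefficients of x^a in the eigenvector equation leaves a scalar factor that must
vanish. Both nilpotency and triangularity of the frame come from this. -/
theorem coeff_eq_zero_of_euler_lie {Z : PolyVectorField n} {d : ℕ}
    (h : ⁅H.euler, Z⁆ = -(d : ℝ) • Z) (m : Fin n) (a : Fin n →₀ ℕ)
    (ha : ∑ q, a q * H.deg q + d ≠ H.deg m) : coeff a (Z (X m)) = 0 := by
  have h1 := congrArg (coeff a) (DFunLike.congr_fun h (X m))
  have e1 : H.euler (X m) = (H.deg m : ℝ) • X m := mkDerivation_X ..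
  rw [Derivation.commutator_apply, Derivation.smul_apply, e1, Derivation.map_smul, coeff_sub,
    coeff_euler, coeff_smul, coeff_smul, smul_eq_mul, smul_eq_mul] at h1
  have h2 : ((∑ q, (a q : ℝ) * H.deg q) + d - H.deg m) * coeff a (Z (X m)) = 0 := by linarith
  refine (mul_eq_zero.1 h2).resolve_left fun h0 => ha ?_
  have : ((∑ q, a q * H.deg q + d : ℕ) : ℝ) = H.deg m := by push_cast; linarith
  exact_mod_cast this

/-- Monomials have weight at least 0 and each ∂/∂x_m has weight at least -s. -/
theorem eq_zero_of_euler_lie {Z : PolyVectorField n} {d : ℕ}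
    (h : ⁅H.euler, Z⁆ = -(d : ℝ) • Z) (hd : s < d) : Z = 0 := by
  apply derivation_ext
  intro m
  ext a
  rw [H.coeff_eq_zero_of_euler_lie h m a (by have := H.deg_le m; omega)]
  simp

theorem field_X_of_deg_lt {i m : Fin n} (h : H.deg m < H.deg i) : H.field i (X m) = 0 := by
  ext a
  rw [H.coeff_eq_zero_of_euler_lie (H.euler_lie_field i) m a (by omega), coeff_zero]

/-- This coefficient has weight 0, hence is constant, and its value is read off at the origin. -/
theorem field_X_of_deg_eq {i m : Fin n} (h : H.deg m = H.deg i) :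
    H.field i (X m) = if m = i then 1 else 0 := by
  have h1 : H.field i (X m) = C (eval 0 (H.field i (X m))) := by
    rw [eval_zero]
    ext a
    rw [coeff_C, constantCoeff_eq]
    split_ifs with ha
    · rw [ha]
    · apply H.coeff_eq_zero_of_euler_lie (H.euler_lie_field i)
      obtain ⟨q, hq⟩ : ∃ q, a q ≠ 0 := by
        by_contra! h0
        exact ha (Finsupp.ext fun q => (h0 q).symm)
      have h2 : a q * H.deg q ≤ ∑ q, a q * H.deg q :=
        Finset.single_le_sum (f := fun q => a q * H.deg q) (fun _ _ => Nat.zero_le _)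
          (Finset.mem_univ q)
      have h3 : 0 < a q * H.deg q := Nat.mul_pos (Nat.pos_of_ne_zero hq) (H.one_le_deg q)
      omega
  rw [h1, H.eval_zero_field]
  split_ifs <;> simp

/-- The span of the Hall elements of degree `d`. -/
def weightSpace (d : ℕ) : Submodule ℝ (PolyVectorField n) :=
  Submodule.span ℝ (H.field '' {k | H.deg k = d})

theorem field_mem_weightSpace (k : Fin n) : H.field k ∈ H.weightSpace (H.deg k) :=
  Submodule.subset_span ⟨k, rfl, rfl⟩

theorem lie_field_mem_of_forall {d e : ℕ} {Y : PolyVectorField n}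
    (Z : PolyVectorField n) (hY : Y ∈ H.weightSpace d)
    (h : ∀ k, H.deg k = d → ⁅H.field k, Z⁆ ∈ H.weightSpace e) : ⁅Y, Z⁆ ∈ H.weightSpace e := by
  induction hY using Submodule.span_induction with
  | mem x hx =>
    obtain ⟨k, hk, rfl⟩ := hx
    exact h k hk
  | zero => rw [PolyVectorField.zero_lie]; exact zero_mem _
  | add x y _ _ hx hy => rw [PolyVectorField.add_lie]; exact add_mem hx hy
  | smul c x _ hx => rw [PolyVectorField.smul_lie]; exact Submodule.smul_mem _ _ hx

/-- Hall's rewriting: the bracket of two Hall elements is a combination of Hall elements. -/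
theorem lie_field_field_mem (i j : Fin n) :
    ⁅H.field i, H.field j⁆ ∈ H.weightSpace (H.deg i + H.deg j) := by
  generalize hd : H.deg i + H.deg j = d
  induction d using Nat.strong_induction_on generalizing i j with
  | _ d IH =>
  -- Inside the induction on the total degree, a downward induction on the smaller of the two
  -- indices.
  have key : ∀ j i, j ≤ i → H.deg i + H.deg j = d →
      ⁅H.field i, H.field j⁆ ∈ H.weightSpace d := by
    intro j
    induction j using WellFoundedGT.induction with
    | ind j ih =>
    intro i hij hd
    rcases hij.eq_or_lt with rfl | hij
    · rw [PolyVectorField.lie_self]; exact zero_mem _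
    by_cases hs : s < d
    · rw [H.eq_zero_of_euler_lie (Z := ⁅H.field i, H.field j⁆) (d := d) _ hs]
      · exact zero_mem _
      · rw [PolyVectorField.leibniz_lie, H.euler_lie_field, H.euler_lie_field,
          PolyVectorField.smul_lie, PolyVectorField.lie_smul, ← add_smul, ← hd]
        congr 1
        push_cast
        ring
    by_cases hq : ∀ p q, H.factors i = some (p, q) → q ≤ j
    · obtain ⟨l, hl⟩ := (H.exists_factors_iff i j).2 ⟨by omega, hij, hq⟩
      have := H.field_mem_weightSpace l
      rwa [H.field_of_some hl, H.deg_bracket l i j hl, hd] at this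
    push Not at hq
    obtain ⟨p, q, hpq, hjq⟩ := hq
    have hqp : q < p := ((H.exists_factors_iff _ _).1 ⟨i, hpq⟩).2.1
    have hdi := H.deg_bracket i p q hpq
    have := H.one_le_deg q
    have := H.one_le_deg p
    have := H.one_le_deg j
    have := H.deg_mono hqp.le
    -- The pair is inadmissible because X_i = [X_p, X_q] with q > j. The inner brackets [X_p, X_j]
    -- and [X_q, X_j] have degree below d, so they expand in Hall elements; the outer brackets then
    -- involve only indices greater than j.
    have e : ⁅H.field i, H.field j⁆ =
        ⁅⁅H.field p, H.field j⁆, H.field q⁆ - ⁅⁅H.field q, H.field j⁆, H.field p⁆ := by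
      rw [H.field_of_some hpq]
      exact PolyVectorField.lie_lie_eq _ _ _
    rw [e]
    apply sub_mem
    · refine H.lie_field_mem_of_forall _ (IH _ (by omega) p j rfl) fun k hk => ?_
      exact ih q hjq k (H.lt_of_deg_lt _ _ (by omega)).le (by omega)
    · refine H.lie_field_mem_of_forall _ (IH _ (by omega) q j rfl) fun k hk => ?_
      have hjk : j < k := H.lt_of_deg_lt _ _ (by omega)
      rcases le_total p k with h | h
      · exact ih p (hjq.trans hqp) k h (by omega)
      · rw [PolyVectorField.neg_lie_swap]
        exact neg_mem (ih k hjk p h (by omega))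
  rcases le_total j i with h | h
  · exact key j i h hd
  · rw [PolyVectorField.neg_lie_swap]
    exact neg_mem (key i j h (by omega))

theorem weightSpace_le (d : ℕ) : H.weightSpace d ≤ Submodule.span ℝ (range H.field) :=
  Submodule.span_mono (image_subset_range _ _)

theorem weightSpace_eq_bot {d : ℕ} (hd : s < d) : H.weightSpace d = ⊥ := by
  rw [weightSpace, Submodule.span_eq_bot]
  rintro _ ⟨k, hk, rfl⟩
  have := H.deg_le k
  have : H.deg k = d := hk
  omega

/-- The Lie algebra spanned by the Hall basis. -/
def algebra : LieSubalgebra ℝ (PolyVectorField n) where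
  __ := Submodule.span ℝ (range H.field)
  lie_mem' := by
    intro Y Z hY hZ
    induction hY using Submodule.span_induction with
    | mem x hx =>
      obtain ⟨i, rfl⟩ := hx
      induction hZ using Submodule.span_induction with
      | mem y hy =>
        obtain ⟨j, rfl⟩ := hy
        exact H.weightSpace_le _ (H.lie_field_field_mem i j)
      | zero => rw [PolyVectorField.lie_zero]; exact zero_mem (Submodule.span ℝ (range H.field))
      | add x y _ _ hx hy => rw [PolyVectorField.lie_add]; exact add_mem (S := Submodule ℝ _) hx hy
      | smul c x _ hx => rw [PolyVectorField.lie_smul]; exact Submodule.smul_mem _ _ hx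
    | zero => rw [PolyVectorField.zero_lie]; exact zero_mem (Submodule.span ℝ (range H.field))
    | add x y _ _ hx hy => rw [PolyVectorField.add_lie]; exact add_mem (S := Submodule ℝ _) hx hy
    | smul c x _ hx => rw [PolyVectorField.smul_lie]; exact Submodule.smul_mem _ _ hx

/-- The Hall basis as a basis of the Lie algebra that it spans. -/
def basis : Module.Basis (Fin n) ℝ H.algebra := Module.Basis.span H.linearIndependent_field

theorem coe_basis (i : Fin n) : (H.basis i : PolyVectorField n) = H.field i :=
  congrArg Subtype.val (Module.Basis.span_apply H.linearIndependent_field i)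

theorem basis_of_some {l : Fin n} {p : Fin n × Fin n} (h : H.factors l = some p) :
    H.basis l = ⁅H.basis p.1, H.basis p.2⁆ := by
  apply Subtype.ext
  rw [LieSubalgebra.coe_bracket, coe_basis, coe_basis, coe_basis, H.field_of_some h]

/-- `coordinates` is a `Function.invFun`, meaningful here because the fields are independent and Y
lies in their span. -/
theorem coordinates_field (Y : H.algebra) :
    coordinates H.field (Y : PolyVectorField n) = H.basis.repr Y := by
  have hinj : Function.Injective fun c : Fin n → ℝ => ∑ k, c k • H.field k := by
    exact H.linearIndependent_field.fintypeLinearCombination_injective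
  have : (Y : PolyVectorField n) = (fun c : Fin n → ℝ => ∑ k, c k • H.field k) (H.basis.repr Y) := by
    have h := congrArg H.algebra.toSubmodule.subtype (H.basis.sum_repr Y)
    rw [map_sum] at h
    refine h.symm.trans (Finset.sum_congr rfl fun k _ => ?_)
    rw [map_smul, ← coe_basis]
    rfl
  rw [coordinates]
  conv_lhs => rw [this]
  exact Function.leftInverse_invFun hinj _

theorem ad_basis_pow_coe_mem (i j : Fin n) (k : ℕ) :
    (((LieAlgebra.ad ℝ H.algebra (H.basis j) ^ k) (H.basis i) : H.algebra) : PolyVectorField n) ∈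
      H.weightSpace (H.deg i + k * H.deg j) := by
  induction k with
  | zero => simpa [coe_basis] using H.field_mem_weightSpace i
  | succ k ih =>
    rw [pow_succ', Module.End.mul_apply, LieAlgebra.ad_apply, LieSubalgebra.coe_bracket, coe_basis,
      PolyVectorField.neg_lie_swap]
    refine neg_mem (H.lie_field_mem_of_forall _ ih fun m hm => ?_)
    have := H.lie_field_field_mem m j
    rwa [show H.deg i + (k + 1) * H.deg j = H.deg m + H.deg j by rw [hm]; ring]

/-- Each bracket with X_j raises the degree by at least 1, and s of them exceed the largest degree
s. -/
theorem ad_basis_pow_eq_zero (j : Fin n) {k : ℕ} (hk : s ≤ k) :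
    LieAlgebra.ad ℝ H.algebra (H.basis j) ^ k = 0 := by
  refine H.basis.ext fun i => ?_
  have h := H.ad_basis_pow_coe_mem i j k
  have h1 : k * 1 ≤ k * H.deg j := Nat.mul_le_mul_left k (H.one_le_deg j)
  have h2 := H.one_le_deg i
  rw [H.weightSpace_eq_bot (by omega), Submodule.mem_bot] at h
  exact Subtype.ext h

end HallBasis
-- Exponentials of nilpotent inner derivations, and folds of operators.
variable {L : Type*} [LieRing L] [LieAlgebra ℝ L]

/-- The truncated exponential series of `ad x`. -/
def expAd (N : ℕ) (x : L) : Module.End ℝ L :=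
  ∑ k ∈ Finset.range N, (k.factorial : ℝ)⁻¹ • LieAlgebra.ad ℝ L x ^ k

theorem expAd_eq_exp [LieAlgebra ℚ L] {N : ℕ} {x : L} (h : LieAlgebra.ad ℝ L x ^ N = 0) :
    expAd N x = IsNilpotent.exp (LieAlgebra.ad ℝ L x) := by
  rw [IsNilpotent.exp_eq_sum h, expAd]
  refine Finset.sum_congr rfl fun k _ => ?_
  rw [← Rat.cast_smul_eq_qsmul ℝ]
  simp

/-- A real Lie algebra as a rational one. -/
@[reducible] def ratLieAlgebra (L : Type*) [LieRing L] [LieAlgebra ℝ L] : LieAlgebra ℚ L :=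
  { Module.compHom L (algebraMap ℚ ℝ) with
    lie_smul := fun q x y => lie_smul (algebraMap ℚ ℝ q) x y }

/-- The exponential of a nilpotent derivation is an automorphism; the rational structure needed for
it is introduced only inside the proof. -/
theorem expAd_lie {N : ℕ} {x : L} (h : LieAlgebra.ad ℝ L x ^ N = 0) (y z : L) :
    expAd N x ⁅y, z⁆ = ⁅expAd N x y, expAd N x z⁆ := by
  let _ := ratLieAlgebra L
  have h1 : (LieDerivation.ad ℝ L x).toLinearMap = LieAlgebra.ad ℝ L x :=
    LieDerivation.coe_ad_apply_eq_ad_apply x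
  have h' : (LieDerivation.ad ℝ L x).toLinearMap ^ N = 0 := h1 ▸ h
  have hn : IsNilpotent (LieDerivation.ad ℝ L x).toLinearMap := ⟨N, h'⟩
  rw [expAd_eq_exp h, ← h1]
  exact (LieDerivation.exp (LieDerivation.ad ℝ L x) hn).map_lie y z

theorem expAd_add_smul {N : ℕ} {x : L} (h : LieAlgebra.ad ℝ L x ^ N = 0) (a b : ℝ) :
    expAd N ((a + b) • x) = expAd N (a • x) * expAd N (b • x) := by
  let _ := ratLieAlgebra L
  have hc (c : ℝ) : LieAlgebra.ad ℝ L (c • x) ^ N = 0 := by rw [map_smul, smul_pow, h, smul_zero]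
  rw [expAd_eq_exp (hc _), expAd_eq_exp (hc _), expAd_eq_exp (hc _), add_smul, map_add]
  refine IsNilpotent.exp_add_of_commute ?_ ⟨N, hc a⟩ ⟨N, hc b⟩
  rw [map_smul, map_smul]
  exact ((Commute.refl _).smul_left a).smul_right b

theorem expAd_zero {N : ℕ} (hN : N ≠ 0) : expAd N (0 : L) = 1 := by
  rw [expAd, Finset.sum_eq_single_of_mem 0 (by simpa using Nat.pos_of_ne_zero hN)]
  · simp
  · intro k _ hk
    simp [hk]

theorem expAd_smul_apply (N : ℕ) (x : L) (t : ℝ) (y : L) : expAd N (t • x) y =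
    ∑ k ∈ Finset.range N, ((k.factorial : ℝ)⁻¹ * t ^ k) • (LieAlgebra.ad ℝ L x ^ k) y := by
  simp only [expAd, map_smul, smul_pow, LinearMap.sum_apply, LinearMap.smul_apply, smul_smul]

/-- The exponential of a nilpotent `ad x` as an automorphism. -/
def expAdEquiv (N : ℕ) (hN : N ≠ 0) (x : L) (h : LieAlgebra.ad ℝ L x ^ N = 0) : L ≃ₗ⁅ℝ⁆ L :=
  { expAd N x with
    map_lie' := expAd_lie h _ _
    invFun := expAd N (-x)
    left_inv := fun y => by
      have := expAd_add_smul h (-1) 1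
      rw [neg_add_cancel, zero_smul, expAd_zero hN, neg_one_smul, one_smul] at this
      exact (DFunLike.congr_fun this y).symm
    right_inv := fun y => by
      have := expAd_add_smul h 1 (-1)
      rw [add_neg_cancel, zero_smul, expAd_zero hN, neg_one_smul, one_smul] at this
      exact (DFunLike.congr_fun this y).symm }

theorem expAdEquiv_apply (N : ℕ) (hN : N ≠ 0) (x : L) (h : LieAlgebra.ad ℝ L x ^ N = 0) (y : L) :
    expAdEquiv N hN x h y = expAd N x y := rfl

section foldl

variable {R A M : Type*} [CommSemiring R] [AddCommMonoid M] [Module R M]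

/-- A left fold applies the head of the list first, so the operators multiply in the opposite ring.
As a product, the fold is multilinear in its operators. -/
theorem foldl_apply_eq_prod {ι : Type*} (l : List ι) (f : ι → Module.End R M) (y : M) :
    l.foldl (fun z j => f j z) y = (l.map fun j => MulOpposite.op (f j)).prod.unop y := by
  induction l generalizing y with
  | nil => rfl
  | cons a l ih => simp [ih]

/-- Expansion of a composition of finite sums. -/
theorem foldl_finRange_sum {n : ℕ} {α : Type*} (t : Finset α) (g : Fin n → α → Module.End R M)
    (y : M) : (List.finRange n).foldl (fun z j => (∑ k ∈ t, g j k) z) y =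
      ∑ a ∈ Fintype.piFinset fun _ => t, (List.finRange n).foldl (fun z j => g j (a j) z) y := by
  have h := (MultilinearMap.mkPiAlgebraFin R n (Module.End R M)ᵐᵒᵖ).map_sum_finset
    (fun j k => MulOpposite.op (g j k)) fun _ => t
  simp only [MultilinearMap.mkPiAlgebraFin_apply, List.ofFn_eq_map] at h
  have h2 := DFunLike.congr_fun (congrArg MulOpposite.unop h) y
  rw [Finset.unop_sum, LinearMap.sum_apply] at h2
  rw [foldl_apply_eq_prod (f := fun j => ∑ k ∈ t, g j k)]
  simp only [Finset.op_sum]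
  rw [h2]
  exact Finset.sum_congr rfl fun a _ => (foldl_apply_eq_prod (f := fun j => g j (a j)) ..).symm

end foldl

theorem foldl_smul_apply {R M ι : Type*} [CommSemiring R] [AddCommMonoid M] [Module R M]
    (l : List ι) (c : ι → R) (f : ι → Module.End R M) (y : M) :
    l.foldl (fun z j => (c j • f j) z) y = (l.map c).prod • l.foldl (fun z j => f j z) y := by
  rw [foldl_apply_eq_prod (f := fun j => c j • f j), foldl_apply_eq_prod (f := f)]
  induction l generalizing y with
  | nil => simp
  | cons a l ih =>
    simp only [MulOpposite.op_smul] at ih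
    simp [ih, smul_smul]

/-! ### Extremal polynomials through products of exponentials. -/

namespace HallBasis
open MvPolynomial

variable {r s n : ℕ} (H : HallBasis r s n)

theorem step_ne_zero {r s n : ℕ} (H : HallBasis r s n) (j : Fin n) : s ≠ 0 := by
  have := H.one_le_deg j
  have := H.deg_le j
  omega

/-- The automorphism `e^{t ad X_j}`. -/
def expAdField (j : Fin n) (t : ℝ) : H.algebra ≃ₗ⁅ℝ⁆ H.algebra :=
  expAdEquiv s (H.step_ne_zero j) (t • H.basis j) (by
    rw [map_smul, smul_pow, H.ad_basis_pow_eq_zero j le_rfl, smul_zero])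

theorem expAdField_apply (j : Fin n) (t : ℝ) (y : H.algebra) :
    H.expAdField j t y =
      (∑ k ∈ Finset.range s,
        ((k.factorial : ℝ)⁻¹ * t ^ k) • LieAlgebra.ad ℝ H.algebra (H.basis j) ^ k) y := by
  rw [expAdField, expAdEquiv_apply, expAd_smul_apply, LinearMap.sum_apply]
  rfl

theorem expAdField_add (j : Fin n) (t u : ℝ) (y : H.algebra) :
    H.expAdField j (t + u) y = H.expAdField j t (H.expAdField j u y) := by
  simp only [expAdField, expAdEquiv_apply]
  exact DFunLike.congr_fun (expAd_add_smul (H.ad_basis_pow_eq_zero j le_rfl) t u) y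

theorem expAdField_zero (j : Fin n) (y : H.algebra) : H.expAdField j 0 y = y := by
  rw [expAdField, expAdEquiv_apply, zero_smul, expAd_zero (H.step_ne_zero j)]
  rfl

theorem expAdField_self (j : Fin n) (t : ℝ) : H.expAdField j t (H.basis j) = H.basis j := by
  rw [expAdField_apply, LinearMap.sum_apply, Finset.sum_eq_single_of_mem 0
    (by simpa using Nat.pos_of_ne_zero (H.step_ne_zero j))]
  · simp
  · intro k _ hk
    obtain ⟨k, rfl⟩ := Nat.exists_eq_succ_of_ne_zero hk
    simp [pow_succ]

/-- The automorphism `e^{x_{m-1} ad X_{m-1}} ⋯ e^{x_0 ad X_0}`. -/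
def expAdProd (x : Fin n → ℝ) : ℕ → (H.algebra ≃ₗ⁅ℝ⁆ H.algebra)
  | 0 => LieEquiv.refl
  | m + 1 => if h : m < n then (expAdProd x m).trans (H.expAdField ⟨m, h⟩ (x ⟨m, h⟩))
      else expAdProd x m

theorem expAdProd_succ (x : Fin n → ℝ) (m : Fin n) (y : H.algebra) :
    H.expAdProd x (m + 1) y = H.expAdField m (x m) (H.expAdProd x m y) := by
  rw [expAdProd, dif_pos m.2]
  rfl

theorem expAdProd_eq_foldl (x : Fin n → ℝ) (y : H.algebra) {m : ℕ} (hm : m ≤ n) :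
    H.expAdProd x m y =
      ((List.finRange n).take m).foldl (fun z j => H.expAdField j (x j) z) y := by
  induction m with
  | zero => rfl
  | succ m ih =>
    rw [H.expAdProd_succ x ⟨m, hm⟩, ih (Nat.le_of_succ_le hm),
      List.take_succ_eq_append_getElem (by simpa using hm), List.foldl_append]
    simp

/-- Bracketing on the right with X_j is -ad X_j; these signs will cancel the factor (-1)^{|α|} in
P_i^v. -/
theorem iterBracket_eq_foldl (y : H.algebra) (a : Fin n →₀ ℕ) :
    iterBracket H.basis y a = (List.finRange n).foldl
      (fun z j => ((-LieAlgebra.ad ℝ H.algebra (H.basis j)) ^ a j) z) y := by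
  rw [iterBracket]
  congr 1
  funext z j
  rw [Module.End.pow_apply]
  congr 1
  funext w
  simp

theorem coe_iterBracket (y : H.algebra) (a : Fin n →₀ ℕ) :
    ((iterBracket H.basis y a : H.algebra) : PolyVectorField n) =
      iterBracket H.field (y : PolyVectorField n) a := by
  rw [iterBracket, iterBracket]
  refine (List.foldl_hom Subtype.val fun z j => ?_).symm
  refine (Function.Semiconj.iterate_right (f := Subtype.val) (fun w => ?_) (a j) z).symm
  rw [← coe_basis]
  rfl

/-- The linear functional on the Lie algebra with the coordinates `v`. -/
def covector (v : Fin n → ℝ) : H.algebra →ₗ[ℝ] ℝ := H.basis.constr ℝ v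

theorem covector_basis (v : Fin n → ℝ) (i : Fin n) : H.covector v (H.basis i) = v i :=
  Module.Basis.constr_basis _ _ _ _

theorem sum_coordinates_mul (v : Fin n → ℝ) (y : H.algebra) :
    ∑ k, coordinates H.field (y : PolyVectorField n) k * v k = H.covector v y := by
  rw [coordinates_field, covector, Module.Basis.constr_apply_fintype]
  rfl

theorem phi_eq (i : Fin n) (a : Fin n →₀ ℕ) (v : Fin n → ℝ) :
    H.phi i a v = signedInvFactorial a * H.covector v (iterBracket H.basis (H.basis i) a) := by
  simp only [phi, structConst]
  rw [← sum_coordinates_mul, coe_iterBracket, coe_basis]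

/-- Confines the support to the box a_j < s. With an infinite support `∑ᶠ` would default to 0. -/
theorem phi_eq_zero (i : Fin n) {a : Fin n →₀ ℕ} (v : Fin n → ℝ) {j : Fin n} (hj : s ≤ a j) :
    H.phi i a v = 0 := by
  rw [phi_eq, iterBracket_eq_foldl,
    foldl_apply_eq_prod (f := fun j => (-LieAlgebra.ad ℝ H.algebra (H.basis j)) ^ a j),
    List.prod_eq_zero]
  · simp
  · refine List.mem_map.2 ⟨j, List.mem_finRange j, ?_⟩
    rw [neg_pow, H.ad_basis_pow_eq_zero j hj, mul_zero, MulOpposite.op_zero]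

theorem extremalPoly_eq_sum (v : Fin n → ℝ) (i : Fin n) :
    H.extremalPoly v i = ∑ a ∈ Fintype.piFinset fun _ : Fin n => Finset.range s,
      monomial (Finsupp.equivFunOnFinite.symm a) (H.phi i (Finsupp.equivFunOnFinite.symm a) v) := by
  rw [extremalPoly, finsum_eq_sum_of_support_subset
    (s := (Fintype.piFinset fun _ : Fin n => Finset.range s).map
      Finsupp.equivFunOnFinite.symm.toEmbedding), Finset.sum_map]
  · rfl
  · intro a ha
    simp only [Finset.coe_map, Equiv.coe_toEmbedding, mem_image, Finset.mem_coe,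
      Fintype.mem_piFinset, Finset.mem_range]
    refine ⟨a, fun j => ?_, by simp⟩
    by_contra h
    exact ha (by simp [H.phi_eq_zero i v (not_lt.1 h)])

/-- `P_i^v(x) = ⟨v, e^{x_n ad X_n} ⋯ e^{x_1 ad X_1} X_i⟩`. -/
theorem eval_extremalPoly (x v : Fin n → ℝ) (i : Fin n) :
    eval x (H.extremalPoly v i) = H.covector v (H.expAdProd x n (H.basis i)) := by
  have h1 : (List.finRange n).take n = List.finRange n := List.take_of_length_le (by simp)
  rw [expAdProd_eq_foldl _ _ _ le_rfl, h1]
  simp only [expAdField_apply]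
  rw [foldl_finRange_sum (g := fun j (k : ℕ) => ((k.factorial : ℝ)⁻¹ * x j ^ k) •
    LieAlgebra.ad ℝ H.algebra (H.basis j) ^ k), map_sum, extremalPoly_eq_sum, map_sum]
  refine Finset.sum_congr rfl fun a _ => ?_
  -- The sign is inserted twice: one copy becomes the sign in φ_{iα}, the other turns ad X_j into
  -- -ad X_j.
  have h2 (j : Fin n) : ((a j).factorial : ℝ)⁻¹ * x j ^ a j =
      ((a j).factorial : ℝ)⁻¹ * (-1) ^ a j * x j ^ a j * (-1) ^ a j := by
    have : ((-1 : ℝ) ^ a j) * (-1) ^ a j = 1 := by rw [← mul_pow]; simp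
    linear_combination (-((a j).factorial : ℝ)⁻¹ * x j ^ a j) * this
  have h3 (j : Fin n) : (((a j).factorial : ℝ)⁻¹ * x j ^ a j) •
      LieAlgebra.ad ℝ H.algebra (H.basis j) ^ a j =
      (((a j).factorial : ℝ)⁻¹ * (-1) ^ a j * x j ^ a j) •
        (-LieAlgebra.ad ℝ H.algebra (H.basis j)) ^ a j := by
    rw [h2, mul_smul, ← smul_pow, neg_one_smul]
  simp only [h3]
  rw [foldl_smul_apply (f := fun j => (-LieAlgebra.ad ℝ H.algebra (H.basis j)) ^ a j), map_smul,
    eval_monomial, phi_eq, iterBracket_eq_foldl, ← Fin.prod_univ_def, Finset.prod_mul_distrib,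
    Finset.prod_mul_distrib, Finset.prod_inv_distrib, Finset.prod_pow_eq_pow_sum,
    signedInvFactorial, multiFactorial, Finsupp.degree_eq_sum, Nat.cast_prod,
    Finsupp.prod_fintype _ _ (by simp), smul_eq_mul]
  simp only [Finsupp.equivFunOnFinite_symm_apply_apply]
  ring

theorem eval_zero_extremalPoly (v : Fin n → ℝ) (i : Fin n) :
    eval 0 (H.extremalPoly v i) = v i := by
  have (m : ℕ) (y : H.algebra) : H.expAdProd 0 m y = y := by
    induction m with
    | zero => rfl
    | succ m ih =>
      by_cases h : m < n
      · exact (H.expAdProd_succ 0 ⟨m, h⟩ y).trans (by rw [ih]; exact H.expAdField_zero _ _)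
      · rw [expAdProd, dif_neg h, ih]
  rw [eval_extremalPoly, this, covector_basis]

/-- The numbers P_i^v(x) are the values of v on the image of a basis under an automorphism, so they
determine v. -/
theorem eq_zero_of_eval_extremalPoly {x v : Fin n → ℝ}
    (h : ∀ i, eval x (H.extremalPoly v i) = 0) : v = 0 := by
  have h1 : (H.covector v).comp ((H.expAdProd x n : H.algebra ≃ₗ⁅ℝ⁆ H.algebra) :
      H.algebra →ₗ⁅ℝ⁆ H.algebra).toLinearMap = 0 := by
    refine H.basis.ext fun i => ?_
    have := h i
    rw [eval_extremalPoly] at this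
    exact this
  funext i
  have h2 := DFunLike.congr_fun h1 ((H.expAdProd x n).symm (H.basis i))
  have h3 : H.covector v (H.expAdProd x n ((H.expAdProd x n).symm (H.basis i))) = 0 := h2
  rwa [LieEquiv.apply_symm_apply, covector_basis] at h3

end HallBasis

/-! ### Elimination of Hall elements: a generator in the moving frame. -/

namespace HallBasis
open MvPolynomial

variable {r s n : ℕ} (H : HallBasis r s n)

/-- The value at `x` of the coefficient `(-1)^{|I(ℓ)|} / I(ℓ)! x^{I(ℓ)}`. -/
def gradedCoeff (x : Fin n → ℝ) (l : Fin n) : ℝ :=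
  ∏ q, ((H.multiIndex l q).factorial : ℝ)⁻¹ * (-x q) ^ H.multiIndex l q

/-- The part of the coefficient of `∂/∂x_ℓ` that does not involve `x_m`. -/
def gradedCoeffErase (x : Fin n → ℝ) (m l : Fin n) : ℝ :=
  ∏ q ∈ Finset.univ.erase m, ((H.multiIndex l q).factorial : ℝ)⁻¹ * (-x q) ^ H.multiIndex l q

theorem gradedCoeff_eq (x : Fin n → ℝ) (m l : Fin n) : H.gradedCoeff x l =
    (((H.multiIndex l m).factorial : ℝ)⁻¹ * (-x m) ^ H.multiIndex l m) *
      H.gradedCoeffErase x m l :=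
  (Finset.mul_prod_erase _ _ (Finset.mem_univ m)).symm

theorem eval_genField (x : Fin n → ℝ) (i l : Fin n) :
    eval x (H.genField i (X l)) = if H.head l = i then H.gradedCoeff x l else 0 := by
  rw [genField, mkDerivation_X]
  split_ifs
  · rw [eval_monomial, Finsupp.prod_fintype _ _ (by simp), signedInvFactorial, multiFactorial,
      Finsupp.degree_eq_sum, Nat.cast_prod, gradedCoeff, Finset.prod_mul_distrib,
      Finset.prod_inv_distrib]
    simp only [neg_pow (x _)]
    rw [Finset.prod_mul_distrib, Finset.prod_pow_eq_pow_sum]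
    ring
  · simp

/-- The Hall elements with head `X_i` that are left after the elements before `X_m` have been
eliminated. -/
def stage (i : Fin n) (m : ℕ) : Finset (Fin n) :=
  Finset.univ.filter fun l => H.head l = i ∧ m ≤ (l : ℕ) ∧ ∀ q, H.multiIndex l q ≠ 0 → (q : ℕ) < m

/-- The Hall elements after `X_m` that have head `X_i`, right factors at most `X_m`, and contain
`X_m` exactly `k` times as a right factor. -/
def substage (i m : Fin n) (k : ℕ) : Finset (Fin n) :=
  Finset.univ.filter fun l =>
    H.head l = i ∧ m < l ∧ (∀ q, H.multiIndex l q ≠ 0 → q ≤ m) ∧ H.multiIndex l m = k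

theorem lie_basis_eq_zero {i j : Fin n} (h : s < H.deg i + H.deg j) :
    ⁅H.basis i, H.basis j⁆ = 0 := by
  have := H.lie_field_field_mem i j
  rw [H.weightSpace_eq_bot h, Submodule.mem_bot, ← coe_basis, ← coe_basis] at this
  exact Subtype.ext this

/-- Sending [X_p, X_m] to X_p embeds level k + 1 into level k and leaves the coefficient without x_m
unchanged. An element X_l outside the image satisfies [X_l, X_m] = 0, since otherwise the pair would
be admissible. -/
theorem sum_substage_succ (x : Fin n → ℝ) (i m : Fin n) (k : ℕ) :
    ∑ l ∈ H.substage i m (k + 1), H.gradedCoeffErase x m l • H.basis l =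
      ∑ l ∈ H.substage i m k, H.gradedCoeffErase x m l • ⁅H.basis l, H.basis m⁆ := by
  have hleft : ∀ l ∈ H.substage i m (k + 1), ∃ p, H.factors l = some (p, m) := fun l hl => by
    simp only [substage, Finset.mem_filter] at hl
    exact H.exists_left_of_multiIndex_ne_zero hl.2.2.2.1 (by omega)
  -- The default value l is never taken on level k + 1, where X_m occurs and so there is a
  -- factorization.
  let e : Fin n → Fin n := fun l => (H.factors l).elim l Prod.fst
  have he {l p : Fin n} (h : H.factors l = some (p, m)) : e l = p := by simp [e, h]
  refine Finset.sum_of_injOn e ?_ ?_ ?_ ?_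
  · intro l hl l' hl' h
    obtain ⟨p, hp⟩ := hleft l hl
    obtain ⟨p', hp'⟩ := hleft l' hl'
    rw [he hp, he hp'] at h
    exact H.factors_inj l l' _ hp (h ▸ hp')
  · intro l hl
    obtain ⟨p, hp⟩ := hleft l hl
    rw [he hp]
    simp only [substage, Finset.coe_filter, Finset.mem_univ, true_and, mem_ofPred_eq] at hl ⊢
    refine ⟨by rw [← hl.1, H.head_of_some hp], ((H.exists_factors_iff _ _).1 ⟨l, hp⟩).2.1,
      fun q hq => H.le_right_of_multiIndex_left_ne_zero hp hq, ?_⟩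
    have := hl.2.2.2
    rw [H.multiIndex_of_some hp] at this
    simpa using this
  · intro l hl hne
    simp only [substage, Finset.mem_filter, Finset.mem_univ, true_and] at hl
    rw [H.lie_basis_eq_zero, smul_zero]
    by_contra hd
    obtain ⟨l', hl'⟩ := H.exists_factors_eq_some hl.2.1 hl.2.2.1 (not_lt.1 hd)
    refine hne ⟨l', ?_, he hl'⟩
    simp only [substage, Finset.coe_filter, Finset.mem_univ, true_and, mem_ofPred_eq]
    refine ⟨by rw [← hl.1, H.head_of_some hl'], hl.2.1.trans (H.left_lt hl'),
      fun q hq => H.le_right_of_multiIndex_ne_zero hl' hq, ?_⟩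
    rw [H.multiIndex_of_some hl']
    simp [hl.2.2.2]
  · intro l hl
    obtain ⟨p, hp⟩ := hleft l hl
    rw [he hp, H.basis_of_some hp]
    congr 1
    refine Finset.prod_congr rfl fun q hq => ?_
    have : H.multiIndex l q = H.multiIndex p q := by
      rw [H.multiIndex_of_some hp, Finsupp.add_apply,
        Finsupp.single_eq_of_ne (Finset.ne_of_mem_erase hq), add_zero]
    rw [this]

theorem ad_pow_sum_substage (x : Fin n → ℝ) (i m : Fin n) (k : ℕ) :
    (LieAlgebra.ad ℝ H.algebra (H.basis m) ^ k)
      (∑ l ∈ H.substage i m 0, H.gradedCoeffErase x m l • H.basis l) =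
    (-1 : ℝ) ^ k • ∑ l ∈ H.substage i m k, H.gradedCoeffErase x m l • H.basis l := by
  induction k with
  | zero => simp
  | succ k ih =>
    rw [pow_succ', Module.End.mul_apply, ih, map_smul, pow_succ, mul_smul, sum_substage_succ,
      map_sum,
      neg_one_smul, ← Finset.sum_neg_distrib]
    congr 1
    refine Finset.sum_congr rfl fun l _ => ?_
    rw [map_smul, LieAlgebra.ad_apply, ← lie_skew, smul_neg]

theorem multiIndex_lt_step (l m : Fin n) : H.multiIndex l m < s := by
  have h1 := H.deg_eq l
  have h2 := H.deg_le l
  have h3 : H.multiIndex l m * H.deg m ≤ ∑ q, H.multiIndex l q * H.deg q :=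
    Finset.single_le_sum (f := fun q => H.multiIndex l q * H.deg q) (fun _ _ => Nat.zero_le _)
      (Finset.mem_univ m)
  have h4 : H.multiIndex l m * 1 ≤ H.multiIndex l m * H.deg m :=
    Nat.mul_le_mul_left _ (H.one_le_deg m)
  omega

/-- Sorts the elements by the number k of copies of X_m; k < s by `multiIndex_lt_step`. -/
theorem sum_stage_succ (x : Fin n → ℝ) (i m : Fin n) :
    ∑ l ∈ H.stage i (m + 1), H.gradedCoeff x l • H.basis l =
      ∑ k ∈ Finset.range s, ((k.factorial : ℝ)⁻¹ * (-x m) ^ k) •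
        ∑ l ∈ H.substage i m k, H.gradedCoeffErase x m l • H.basis l := by
  rw [← Finset.sum_fiberwise_of_maps_to (g := fun l => H.multiIndex l m) (t := Finset.range s)
    fun l _ => Finset.mem_range.2 (H.multiIndex_lt_step l m)]
  refine Finset.sum_congr rfl fun k _ => ?_
  rw [Finset.smul_sum]
  refine Finset.sum_congr ?_ fun l hl => ?_
  · ext l
    simp only [stage, substage, Finset.mem_filter, Finset.mem_univ, true_and, Fin.lt_def,
      Fin.le_def, Nat.lt_succ_iff, Nat.succ_le_iff, and_assoc]
  · have hk : H.multiIndex l m = k := by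
      simp only [substage, Finset.mem_filter] at hl
      exact hl.2.2.2.2
    rw [H.gradedCoeff_eq x m l, hk, mul_smul]

theorem sum_stage (x : Fin n → ℝ) (i m : Fin n) :
    ∑ l ∈ H.stage i m, H.gradedCoeff x l • H.basis l =
      (if H.head m = i then H.gradedCoeff x m • H.basis m else 0) +
        ∑ l ∈ H.substage i m 0, H.gradedCoeffErase x m l • H.basis l := by
  have h1 : ∑ l ∈ H.substage i m 0, H.gradedCoeffErase x m l • H.basis l =
      ∑ l ∈ H.substage i m 0, H.gradedCoeff x l • H.basis l := by
    refine Finset.sum_congr rfl fun l hl => ?_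
    simp only [substage, Finset.mem_filter] at hl
    rw [H.gradedCoeff_eq x m l, hl.2.2.2.2]
    simp
  have h2 : (if H.head m = i then H.gradedCoeff x m • H.basis m else 0) =
      ∑ l ∈ Finset.univ.filter (fun l => l = m ∧ H.head l = i), H.gradedCoeff x l • H.basis l := by
    split_ifs with h
    · rw [Finset.sum_eq_single_of_mem m (by simp [h])]
      intro l hl hlm
      exact absurd (Finset.mem_filter.1 hl).2.1 hlm
    · rw [Finset.sum_eq_zero]
      intro l hl
      obtain ⟨-, rfl, h'⟩ := Finset.mem_filter.1 hl
      exact absurd h' h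
  rw [h1, h2, ← Finset.sum_union]
  · refine Finset.sum_congr ?_ fun _ _ => rfl
    ext l
    simp only [stage, substage, Finset.mem_filter, Finset.mem_univ, true_and, Finset.mem_union]
    constructor
    · rintro ⟨h1, h2, h3⟩
      rcases (show m ≤ l from h2).eq_or_lt with rfl | h
      · exact .inl ⟨rfl, h1⟩
      · refine .inr ⟨h1, h, fun q hq => le_of_lt (h3 q hq), ?_⟩
        by_contra h0
        exact lt_irrefl _ (h3 m h0)
    · rintro (⟨rfl, h⟩ | ⟨h1, h2, h3, h4⟩)
      · exact ⟨h, le_rfl, fun q hq => H.lt_of_multiIndex_ne_zero hq⟩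
      · refine ⟨h1, le_of_lt h2, fun q hq => lt_of_le_of_ne (h3 q hq) fun h => hq ?_⟩
        rw [Fin.ext h, h4]
  · rw [Finset.disjoint_left]
    intro l hl hl'
    simp only [substage, Finset.mem_filter, Finset.mem_univ, true_and] at hl hl'
    exact hl'.2.1.ne' hl.1

/-- One elimination step. X_m itself is fixed, and the k-th term of e^{x_m ad X_m} carries the
elements without X_m to those with k copies; the factor x_m^k / k! together with (-1)^k is the
missing part of their coefficients. -/
theorem expAdField_sum_stage (x : Fin n → ℝ) (i m : Fin n) :
    H.expAdField m (x m) (∑ l ∈ H.stage i m, H.gradedCoeff x l • H.basis l) =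
      (if H.head m = i then H.gradedCoeff x m • H.basis m else 0) +
        ∑ l ∈ H.stage i (m + 1), H.gradedCoeff x l • H.basis l := by
  rw [sum_stage, map_add]
  congr 1
  · split_ifs
    · rw [map_smul, expAdField_self]
    · exact map_zero _
  · rw [expAdField_apply, LinearMap.sum_apply, sum_stage_succ]
    refine Finset.sum_congr rfl fun k _ => ?_
    rw [LinearMap.smul_apply, ad_pow_sum_substage, smul_smul, neg_pow (x m)]
    congr 1
    ring

/-- The coefficients of a generator, taken in the moving frame, add up to the generator. -/
theorem sum_gradedCoeff_symm (x : Fin n → ℝ) {i : Fin n} (hi : H.factors i = none) :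
    ∑ l, (if H.head l = i then H.gradedCoeff x l else 0) •
      (H.expAdProd x (l + 1)).symm (H.basis l) = H.basis i := by
  -- Invariant: the terms with l < m, plus the surviving stage pulled back, give X_i. At m = 0 the
  -- stage is {X_i}; at m = n it is empty.
  have key : ∀ m ≤ n, (∑ l ∈ Finset.univ.filter fun l : Fin n => (l : ℕ) < m,
      (if H.head l = i then H.gradedCoeff x l else 0) •
        (H.expAdProd x (l + 1)).symm (H.basis l)) +
      (H.expAdProd x m).symm (∑ l ∈ H.stage i m, H.gradedCoeff x l • H.basis l) = H.basis i := by
    intro m hm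
    induction m with
    | zero =>
      have : H.stage i 0 = {i} := by
        ext l
        simp only [stage, Finset.mem_filter, Finset.mem_univ, true_and, Finset.mem_singleton,
          Nat.zero_le, Nat.not_lt_zero]
        constructor
        · rintro ⟨h1, h2⟩
          rcases h : H.factors l with _ | p
          · rwa [H.head_of_none h] at h1
          · exact absurd (H.multiIndex_right_ne_zero h) (h2 _)
        · rintro rfl
          exact ⟨H.head_of_none hi, fun q hq => hq (by simp [H.multiIndex_of_none hi])⟩
      rw [this]
      simp only [Nat.not_lt_zero, Finset.filter_false, Finset.sum_empty, Finset.sum_singleton,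
        zero_add]
      have h1 : H.gradedCoeff x i = 1 := by
        simp [gradedCoeff, H.multiIndex_of_none hi]
      rw [h1, one_smul]
      rfl
    | succ m ih =>
      specialize ih (Nat.le_of_succ_le hm)
      set M : Fin n := ⟨m, hm⟩ with hM
      have hset : (Finset.univ.filter fun l : Fin n => (l : ℕ) < m + 1) =
          insert M (Finset.univ.filter fun l : Fin n => (l : ℕ) < m) := by
        ext l
        simp only [Finset.mem_filter, Finset.mem_univ, true_and, Finset.mem_insert, Fin.ext_iff, hM]
        omega
      rw [hset, Finset.sum_insert (by simp [hM]), ← ih]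
      have h1 := H.expAdField_sum_stage x i M
      have h2 : (H.expAdProd x m).symm (∑ l ∈ H.stage i m, H.gradedCoeff x l • H.basis l) =
          (H.expAdProd x (m + 1)).symm
            (H.expAdField M (x M) (∑ l ∈ H.stage i m, H.gradedCoeff x l • H.basis l)) := by
        apply (H.expAdProd x (m + 1)).injective
        refine Eq.trans ?_ ((H.expAdProd x (m + 1)).apply_symm_apply _).symm
        refine (H.expAdProd_succ x M _).trans ?_
        rw [show ((M : Fin n) : ℕ) = m from rfl, LieEquiv.apply_symm_apply]
      rw [h2, show H.stage i m = H.stage i (M : ℕ) from rfl, h1, map_add,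
        show H.stage i ((M : ℕ) + 1) = H.stage i (m + 1) from rfl]
      have h3 : (H.expAdProd x (m + 1)).symm
          (if H.head M = i then H.gradedCoeff x M • H.basis M else 0) =
          (if H.head M = i then H.gradedCoeff x M else 0) •
            (H.expAdProd x (m + 1)).symm (H.basis M) := by
        split_ifs
        · rw [map_smul]
        · rw [map_zero, zero_smul]
      rw [h3]
      abel
  have h := key n le_rfl
  have h0 : H.stage i n = ∅ := by
    ext l
    simp [stage]
  rw [h0, Finset.sum_empty, map_zero, add_zero] at h
  simpa using h

end HallBasis

/-! ### Derivatives of extremal polynomials and the dual covector field. -/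

namespace MvPolynomial

theorem hasDerivAt_eval_comp {n : ℕ} (p : MvPolynomial (Fin n) ℝ) {g : ℝ → Fin n → ℝ}
    {g' : Fin n → ℝ} {t : ℝ} (h : HasDerivAt g g' t) :
    HasDerivAt (fun u => eval (g u) p) (∑ l, g' l * eval (g t) (pderiv l p)) t := by
  induction p using MvPolynomial.induction_on with
  | C a => simpa using hasDerivAt_const t a
  | add p q hp hq =>
    simpa only [map_add, mul_add, Finset.sum_add_distrib] using hp.fun_add hq
  | mul_X p i hp =>
    have h2 := hp.fun_mul (hasDerivAt_pi.1 h i)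
    simp only [map_mul, eval_X]
    refine h2.congr_deriv ?_
    simp only [Derivation.leibniz, smul_eq_mul, map_add, map_mul, eval_X, mul_add,
      Finset.sum_add_distrib, pderiv_X, Pi.single_apply]
    rw [add_comm]
    congr 1
    · rw [Finset.sum_eq_single_of_mem i (Finset.mem_univ i)]
      · simp [mul_comm]
      · intro l _ hl
        simp [Ne.symm hl]
    · rw [Finset.sum_mul]
      exact Finset.sum_congr rfl fun l _ => by ring

end MvPolynomial

open MvPolynomial

theorem PolyVectorField.apply_eq_sum {n : ℕ} (Y : PolyVectorField n) (f : MvPolynomial (Fin n) ℝ) :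
    Y f = ∑ l, Y (X l) * pderiv l f := by
  have h : Y = ∑ l, Y (X l) • (pderiv l : PolyVectorField n) := by
    apply derivation_ext
    intro i
    rw [PolyVectorField.sum_apply]
    simp [pderiv_X, Pi.single_apply]
  conv_lhs => rw [h, PolyVectorField.sum_apply]
  rfl

namespace HallBasis

variable {r s n : ℕ} (H : HallBasis r s n)

theorem expAdProd_update_of_le (x : Fin n → ℝ) (l : Fin n) (u : ℝ) (y : H.algebra) {m : ℕ}
    (hm : m ≤ l) : H.expAdProd (Function.update x l u) m y = H.expAdProd x m y := by
  induction m with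
  | zero => rfl
  | succ m ih =>
    have hml : m < l := hm
    rw [H.expAdProd_succ _ ⟨m, hml.trans l.2⟩, H.expAdProd_succ _ ⟨m, hml.trans l.2⟩,
      Function.update_of_ne (by rw [Ne, Fin.ext_iff]; exact hml.ne), ih hml.le]

/-- Changing x_l by t inserts e^{t ad X_l} after the factors up to l; T collects the later factors,
which do not depend on t. -/
theorem exists_expAdProd_update (x : Fin n → ℝ) (l : Fin n) :
    ∃ T : H.algebra →ₗ[ℝ] H.algebra, ∀ t y, H.expAdProd (Function.update x l (x l + t)) n y =
      T (H.expAdField l t (H.expAdProd x (l + 1) y)) := by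
  have key : ∀ m, (l : ℕ) + 1 ≤ m → m ≤ n → ∃ T : H.algebra →ₗ[ℝ] H.algebra,
      ∀ t y, H.expAdProd (Function.update x l (x l + t)) m y =
        T (H.expAdField l t (H.expAdProd x (l + 1) y)) := by
    intro m hm
    induction m, hm using Nat.le_induction with
    | base =>
      refine fun _ => ⟨LinearMap.id, fun t y => ?_⟩
      rw [expAdProd_succ, H.expAdProd_update_of_le x l _ y le_rfl, Function.update_self,
        expAdProd_succ, add_comm, expAdField_add]
      rfl
    | succ m hm ih =>
      intro hmn
      obtain ⟨T, hT⟩ := ih (Nat.le_of_succ_le hmn)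
      refine ⟨((H.expAdField ⟨m, hmn⟩ (x ⟨m, hmn⟩) : H.algebra ≃ₗ⁅ℝ⁆ H.algebra) :
        H.algebra →ₗ⁅ℝ⁆ H.algebra).toLinearMap.comp T, fun t y => ?_⟩
      rw [H.expAdProd_succ _ ⟨m, hmn⟩, hT, Function.update_of_ne]
      · rfl
      · rw [Ne, Fin.ext_iff]
        exact (Nat.lt_of_succ_le hm).ne'
  exact key n l.2 le_rfl

theorem hasDerivAt_expAdField (hs : 2 ≤ s) (φ : H.algebra →ₗ[ℝ] ℝ) (l : Fin n) (y : H.algebra) :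
    HasDerivAt (fun t => φ (H.expAdField l t y)) (φ ⁅H.basis l, y⁆) 0 := by
  have h1 : (fun t => φ (H.expAdField l t y)) = fun t => ∑ k ∈ Finset.range s,
      ((k.factorial : ℝ)⁻¹ * t ^ k) *
        φ ((LieAlgebra.ad ℝ H.algebra (H.basis l) ^ k) y) := by
    funext t
    rw [expAdField_apply, LinearMap.sum_apply, map_sum]
    simp only [LinearMap.smul_apply, map_smul, smul_eq_mul]
  rw [h1]
  have h2 := HasDerivAt.fun_sum (u := Finset.range s) (x := (0 : ℝ)) fun k _ =>
    ((hasDerivAt_pow k (0 : ℝ)).const_mul (k.factorial : ℝ)⁻¹).mul_const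
      (φ ((LieAlgebra.ad ℝ H.algebra (H.basis l) ^ k) y))
  refine h2.congr_deriv ?_
  -- Only the linear term of the series contributes at 0, and 2 ≤ s ensures that the truncation
  -- contains it.
  rw [Finset.sum_eq_single_of_mem 1 (Finset.mem_range.2 hs)]
  · simp
  · intro k _ hk
    rcases k with _ | _ | k <;> simp_all

/-- Differentiation inserts ad X_l after the first l + 1 factors; these form an automorphism,
through which the bracket is pulled back to X_i. -/
theorem eval_pderiv_extremalPoly (hs : 2 ≤ s) (x v : Fin n → ℝ) (l i : Fin n) :
    eval x (pderiv l (H.extremalPoly v i)) = H.covector v (H.expAdProd x n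
      ⁅(H.expAdProd x (l + 1)).symm (H.basis l), H.basis i⁆) := by
  obtain ⟨T, hT⟩ := H.exists_expAdProd_update x l
  have h1 : HasDerivAt (fun t : ℝ => Function.update x l (x l + t)) (Pi.single l 1) 0 := by
    rw [hasDerivAt_pi]
    intro m
    by_cases hm : m = l
    · subst hm
      simpa using (hasDerivAt_id (0 : ℝ)).const_add (x m)
    · simpa [hm] using hasDerivAt_const (0 : ℝ) (x m)
  have h2 := hasDerivAt_eval_comp (H.extremalPoly v i) h1
  simp only [eval_extremalPoly, hT, add_zero, Function.update_eq_self] at h2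
  have h3 := H.hasDerivAt_expAdField hs ((H.covector v).comp T) l (H.expAdProd x (l + 1) (H.basis i))
  have h4 := h2.unique h3
  rw [Finset.sum_eq_single_of_mem l (Finset.mem_univ l)
    (fun m _ hm => by rw [Pi.single_eq_of_ne hm, zero_mul]), Pi.single_eq_same, one_mul] at h4
  rw [h4]
  have h5 := hT 0 ⁅(H.expAdProd x (l + 1)).symm (H.basis l), H.basis i⁆
  rw [add_zero, Function.update_eq_self, expAdField_zero,
    (H.expAdProd x (l + 1)).map_lie, LieEquiv.apply_symm_apply] at h5
  rw [h5]
  rfl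

/-- The generators differentiate the extremal polynomials by the structure constants. -/
theorem field_extremalPoly (hs : 2 ≤ s) (v : Fin n → ℝ) {j : Fin n} (hj : H.factors j = none)
    (i : Fin n) : H.field j (H.extremalPoly v i) =
      ∑ k, H.basis.repr ⁅H.basis j, H.basis i⁆ k • H.extremalPoly v k := by
  apply MvPolynomial.funext
  intro x
  rw [PolyVectorField.apply_eq_sum, map_sum, map_sum]
  simp only [map_mul, smul_eval, H.eval_pderiv_extremalPoly hs, eval_extremalPoly,
    H.field_of_none hj, eval_genField]
  have h1 : ∑ k, H.basis.repr ⁅H.basis j, H.basis i⁆ k *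
      H.covector v (H.expAdProd x n (H.basis k)) =
      H.covector v (H.expAdProd x n ⁅H.basis j, H.basis i⁆) := by
    conv_rhs => rw [← H.basis.sum_repr ⁅H.basis j, H.basis i⁆]
    simp only [map_sum, map_smul, smul_eq_mul]
  rw [h1]
  -- The chain rule gives ∑_l (X_j)_l Φ_l⁻¹ X_l in the left slot of the bracket, which is X_j.
  conv_rhs => rw [← H.sum_gradedCoeff_symm x hj]
  simp only [sum_lie, smul_lie, map_sum, map_smul, smul_eq_mul]

theorem lie_field_apply (i j : Fin n) (f : MvPolynomial (Fin n) ℝ) :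
    ⁅H.field j, H.field i⁆ f = ∑ k, H.basis.repr ⁅H.basis j, H.basis i⁆ k • H.field k f := by
  have h := congrArg H.algebra.toSubmodule.subtype (H.basis.sum_repr ⁅H.basis j, H.basis i⁆)
  rw [map_sum] at h
  have h1 : ⁅H.field j, H.field i⁆ =
      ∑ k, H.basis.repr ⁅H.basis j, H.basis i⁆ k • H.field k := by
    rw [← coe_basis, ← coe_basis]
    refine h.symm.trans (Finset.sum_congr rfl fun k _ => ?_)
    rw [map_smul, ← coe_basis]
    rfl
  rw [h1, PolyVectorField.sum_apply]
  rfl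

/-- The matrix of the frame `X_1, …, X_n`. -/
def frame : Matrix (Fin n) (Fin n) (MvPolynomial (Fin n) ℝ) := fun i k => H.field i (X k)

/-- By homogeneity X_i(x_k) vanishes for k < i and equals 1 for k = i. Hence the inverse matrix has
polynomial entries as well. -/
theorem det_frame : H.frame.det = 1 := by
  rw [Matrix.det_of_isUpperTriangular]
  · exact Finset.prod_eq_one fun i _ => (H.field_X_of_deg_eq rfl).trans (if_pos rfl)
  · intro i k hki
    rcases (H.deg_mono (le_of_lt hki)).eq_or_lt with h | h
    · exact (H.field_X_of_deg_eq h).trans (if_neg (ne_of_lt hki))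
    · exact H.field_X_of_deg_lt h

theorem inv_mul_frame : H.frame⁻¹ * H.frame = 1 :=
  Matrix.nonsing_inv_mul _ (by rw [det_frame]; exact isUnit_one)

theorem frame_mul_inv : H.frame * H.frame⁻¹ = 1 :=
  Matrix.mul_nonsing_inv _ (by rw [det_frame]; exact isUnit_one)

/-- The covector field whose components in the dual frame are the extremal polynomials. -/
def dualPoly (v : Fin n → ℝ) : Fin n → MvPolynomial (Fin n) ℝ :=
  H.frame⁻¹.mulVec (H.extremalPoly v)

theorem frame_mulVec_dualPoly (v : Fin n → ℝ) :
    H.frame.mulVec (H.dualPoly v) = H.extremalPoly v := by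
  rw [dualPoly, Matrix.mulVec_mulVec, frame_mul_inv, Matrix.one_mulVec]

theorem sum_dualPoly_mul (v : Fin n → ℝ) (i : Fin n) :
    ∑ k, H.field i (X k) * H.dualPoly v k = H.extremalPoly v i :=
  congrFun (H.frame_mulVec_dualPoly v) i

/-- The adjoint equation as a polynomial identity. Applying X_j to ∑_k X_i(x_k) ξ_k = P_i^v yields
∑_m ξ_m [X_j, X_i](x_m) on one side and a Leibniz expansion on the other; the terms X_j X_i(x_m)
cancel, and the invertible frame is removed. -/
theorem field_dualPoly (hs : 2 ≤ s) (v : Fin n → ℝ) {j : Fin n} (hj : H.factors j = none)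
    (k : Fin n) : H.field j (H.dualPoly v k) =
      -∑ m, pderiv k (H.field j (X m)) * H.dualPoly v m := by
  have h : H.frame.mulVec (fun k => H.field j (H.dualPoly v k)) =
      H.frame.mulVec (fun k => -∑ m, pderiv k (H.field j (X m)) * H.dualPoly v m) := by
    funext i
    have h1 := congrArg (H.field j) (H.sum_dualPoly_mul v i)
    rw [H.field_extremalPoly hs v hj, map_sum] at h1
    simp only [Derivation.leibniz, smul_eq_mul, Finset.sum_add_distrib] at h1
    have h2 : ∑ k, H.basis.repr ⁅H.basis j, H.basis i⁆ k • H.extremalPoly v k =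
        ∑ m, H.dualPoly v m * ⁅H.field j, H.field i⁆ (X m) := by
      simp only [← sum_dualPoly_mul, lie_field_apply, Finset.smul_sum, Finset.mul_sum]
      rw [Finset.sum_comm]
      refine Finset.sum_congr rfl fun m _ => Finset.sum_congr rfl fun k _ => ?_
      rw [mul_smul_comm, mul_comm]
    simp only [Derivation.commutator_apply, mul_sub, Finset.sum_sub_distrib] at h2
    have h3 : ∑ m, H.dualPoly v m * H.field i (H.field j (X m)) =
        ∑ k, H.field i (X k) * ∑ m, pderiv k (H.field j (X m)) * H.dualPoly v m := by
      simp only [fun m => PolyVectorField.apply_eq_sum (H.field i) (H.field j (X m)),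
        Finset.mul_sum]
      rw [Finset.sum_comm]
      refine Finset.sum_congr rfl fun k _ => Finset.sum_congr rfl fun m _ => by ring
    simp only [Matrix.mulVec, dotProduct, frame, mul_neg, Finset.sum_neg_distrib]
    rw [← h3]
    linear_combination h1 + h2
  have h4 := congrArg H.frame⁻¹.mulVec h
  rw [Matrix.mulVec_mulVec, Matrix.mulVec_mulVec, inv_mul_frame, Matrix.one_mulVec,
    Matrix.one_mulVec] at h4
  exact congrFun h4 k

end HallBasis

/-! ### The first two layers and the numbering of their elements. -/

namespace HallBasis
open MvPolynomial

variable {r s n : ℕ} (H : HallBasis r s n)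

theorem deg_gen_eq_one (j : Fin r) : H.deg (H.gen j) = 1 := H.deg_gen _ (H.factors_gen j)

theorem factors_eq_none_of_deg_eq_one {i : Fin n} (h : H.deg i = 1) : H.factors i = none := by
  rcases h1 : H.factors i with _ | p
  · rfl
  · have := H.deg_bracket i p.1 p.2 h1
    have := H.one_le_deg p.1
    have := H.one_le_deg p.2
    omega

theorem exists_gen_eq {i : Fin n} (h : H.factors i = none) : ∃ j : Fin r, H.gen j = i :=
  ⟨⟨i, (H.factors_eq_none_iff i).1 h⟩, rfl⟩

theorem layer_zero : H.layer 0 = H.weightSpace 1 := by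
  rw [layer, weightSpace]
  congr 1
  ext Y
  constructor
  · rintro ⟨j, rfl⟩
    exact ⟨_, H.deg_gen_eq_one j, rfl⟩
  · rintro ⟨k, hk, rfl⟩
    obtain ⟨j, rfl⟩ := H.exists_gen_eq (H.factors_eq_none_of_deg_eq_one hk)
    exact ⟨j, rfl⟩

theorem lie_mem_weightSpace {d e : ℕ} {Y Z : PolyVectorField n} (hY : Y ∈ H.weightSpace d)
    (hZ : Z ∈ H.weightSpace e) : ⁅Y, Z⁆ ∈ H.weightSpace (d + e) := by
  refine H.lie_field_mem_of_forall Z hY fun k hk => ?_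
  rw [PolyVectorField.neg_lie_swap]
  refine neg_mem (H.lie_field_mem_of_forall _ hZ fun m hm => ?_)
  rw [← hk, ← hm, add_comm]
  exact H.lie_field_field_mem m k

theorem layer_one : H.layer 1 = H.weightSpace 2 := by
  apply le_antisymm
  · rw [layer, Submodule.span_le]
    rintro _ ⟨Y, hY, W, hW, rfl⟩
    have hY' : Y ∈ H.layer 0 := hY
    rw [layer_zero] at hY' hW
    have h : ⁅Y, W⁆ ∈ H.weightSpace (1 + 1) := H.lie_mem_weightSpace hY' hW
    exact h
  · rw [weightSpace, Submodule.span_le]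
    rintro _ ⟨k, hk, rfl⟩
    have hk : H.deg k = 2 := hk
    rcases h : H.factors k with _ | p
    · have := H.deg_gen k h
      omega
    · have h0 := H.deg_bracket k p.1 p.2 h
      have h1 := H.one_le_deg p.1
      have h2 := H.one_le_deg p.2
      obtain ⟨j1, hj1⟩ := H.exists_gen_eq (H.factors_eq_none_of_deg_eq_one (i := p.1) (by omega))
      obtain ⟨j2, hj2⟩ := H.exists_gen_eq (H.factors_eq_none_of_deg_eq_one (i := p.2) (by omega))
      rw [layer]
      refine Submodule.subset_span ⟨H.field p.1, ?_, H.field p.2, ?_, H.field_of_some h⟩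
      · rw [← hj1]; exact Submodule.subset_span ⟨j1, rfl⟩
      · rw [← hj2]; exact Submodule.subset_span ⟨j2, rfl⟩

theorem finrank_weightSpace (d : ℕ) : Module.finrank ℝ (H.weightSpace d) =
    (Finset.univ.filter fun k => H.deg k = d).card := by
  have h := finrank_span_eq_card
    (H.linearIndependent_field.comp (Subtype.val : {k // H.deg k = d} → Fin n)
      Subtype.val_injective)
  rw [weightSpace, image_eq_range]
  refine h.trans ?_
  rw [Fintype.card_subtype]

/-- The elements of degree at most `2` are the first `r₁ + r₂` ones. -/
theorem lt_layerDim_add_iff (i : Fin n) :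
    (i : ℕ) < H.layerDim 1 + H.layerDim 2 ↔ H.deg i ≤ 2 := by
  have h1 : H.layerDim 1 + H.layerDim 2 = (Finset.univ.filter fun k => H.deg k ≤ 2).card := by
    rw [layerDim, layerDim, layer_zero, layer_one, finrank_weightSpace, finrank_weightSpace,
      ← Finset.card_union_of_disjoint]
    · congr 1
      ext k
      have := H.one_le_deg k
      simp only [Finset.mem_union, Finset.mem_filter, Finset.mem_univ, true_and]
      omega
    · rw [Finset.disjoint_filter]
      intro k _ h
      omega
  rw [h1]
  -- Numbering by degree makes this set an initial segment, so membership is decided by comparing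
  -- its cardinality with those of `Iio i` and `Iic i`.
  constructor
  · intro h
    by_contra h2
    have : (Finset.univ.filter fun k => H.deg k ≤ 2) ⊆ Finset.Iio i := by
      intro k hk
      rw [Finset.mem_Iio]
      by_contra hik
      have := H.deg_mono (not_lt.1 hik)
      have := (Finset.mem_filter.1 hk).2
      omega
    have := Finset.card_le_card this
    rw [Fin.card_Iio] at this
    omega
  · intro h
    have : Finset.Iic i ⊆ Finset.univ.filter fun k => H.deg k ≤ 2 := by
      intro k hk
      have := H.deg_mono (Finset.mem_Iic.1 hk)
      exact Finset.mem_filter.2 ⟨Finset.mem_univ k, by omega⟩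
    have := Finset.card_le_card this
    rw [Fin.card_Iic] at this
    omega

/-- A linear functional that vanishes on the elements of degree at most `2` vanishes on the
brackets of generators. -/
theorem apply_lie_gen_eq_zero (hs : 2 ≤ s) (φ : PolyVectorField n →ₗ[ℝ] ℝ)
    (h : ∀ i, H.deg i ≤ 2 → φ (H.field i) = 0) (i j : Fin r) :
    φ ⁅H.field (H.gen i), H.field (H.gen j)⁆ = 0 := by
  have key : ∀ i j : Fin r, H.gen j < H.gen i →
      φ ⁅H.field (H.gen i), H.field (H.gen j)⁆ = 0 := by
    intro i j hij
    have hi := H.deg_gen_eq_one i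
    have hj := H.deg_gen_eq_one j
    -- Two generators in decreasing order form an admissible pair because 2 ≤ s.
    obtain ⟨l, hl⟩ := (H.exists_factors_iff (H.gen i) (H.gen j)).2
      ⟨by omega, hij, fun p q hpq => by simp [H.factors_gen i] at hpq⟩
    have hd := H.deg_bracket l _ _ hl
    have := h l (by omega)
    rwa [H.field_of_some hl] at this
  rcases lt_trichotomy (H.gen j) (H.gen i) with h1 | h1 | h1
  · exact key i j h1
  · rw [h1, PolyVectorField.lie_self, map_zero]
  · rw [PolyVectorField.neg_lie_swap, map_neg, key j i h1, neg_zero]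

end HallBasis

/-! ### Uniqueness for linear systems and regularity along curves. -/

theorem AbsolutelyContinuousOnInterval.fun_finset_sum {ι : Type*} {a b : ℝ} (t : Finset ι)
    {f : ι → ℝ → ℝ} (h : ∀ i ∈ t, AbsolutelyContinuousOnInterval (f i) a b) :
    AbsolutelyContinuousOnInterval (fun x => ∑ i ∈ t, f i x) a b := by
  classical
  induction t using Finset.induction_on with
  | empty =>
    simpa using ((LipschitzWith.const (0 : ℝ)).lipschitzOnWith
      (s := uIcc a b)).absolutelyContinuousOnInterval
  | insert i t hi ih =>
    simp only [Finset.sum_insert hi]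
    exact (h i (Finset.mem_insert_self i t)).add
      (ih fun j hj => h j (Finset.mem_insert_of_mem hj))

/-- A nonnegative absolutely continuous function with `f' ≤ K f` and `f(0) = 0` vanishes. -/
theorem AbsolutelyContinuousOnInterval.eq_zero_of_deriv_le {f f' : ℝ → ℝ} {K T : ℝ}
    (hT : 0 ≤ T)
    (hf : AbsolutelyContinuousOnInterval f 0 T) (h0 : f 0 = 0) (hpos : 0 ≤ f T)
    (hd : ∀ᵐ t ∂(volume.restrict (Icc 0 T)), HasDerivAt f (f' t) t ∧ f' t ≤ K * f t) :
    f T = 0 := by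
  -- The product e^{-Kt} f has nonpositive derivative almost everywhere and starts at 0, so f(T) ≤
  -- 0.
  have he : AbsolutelyContinuousOnInterval (fun t => Real.exp (-K * t)) 0 T := by
    apply ContDiffOn.absolutelyContinuousOnInterval
    fun_prop
  have hint := (he.mul hf).integral_deriv_eq_sub
  have hnonneg : 0 ≤ ∫ t in 0..T, -deriv ((fun t => Real.exp (-K * t)) * f) t := by
    apply intervalIntegral.integral_nonneg_of_ae_restrict hT
    filter_upwards [hd] with t ht
    have h1 : HasDerivAt (fun t => Real.exp (-K * t)) (Real.exp (-K * t) * -K) t := by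
      simpa using ((hasDerivAt_id t).const_mul (-K)).exp
    have h2 := h1.mul ht.1
    rw [h2.deriv]
    have h3 := ht.2
    have h4 := Real.exp_pos (-K * t)
    simp only [Pi.zero_apply]
    nlinarith
  rw [intervalIntegral.integral_neg, hint] at hnonneg
  simp only [Pi.mul_apply, h0, mul_zero, sub_zero] at hnonneg
  have h4 := Real.exp_pos (-K * T)
  nlinarith

/-- Uniqueness for linear systems with bounded measurable coefficients. -/
theorem eq_zero_of_linear_ode {n : ℕ} {u : ℝ → Fin n → ℝ} {M : ℝ → Fin n → Fin n → ℝ} {K : ℝ}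
    (hu : ∀ i, AbsolutelyContinuousOnInterval (fun t => u t i) 0 1) (h0 : u 0 = 0)
    (hd : ∀ᵐ t ∂(volume.restrict (Icc (0 : ℝ) 1)),
      (∀ i k, |M t i k| ≤ K) ∧ ∀ i, HasDerivAt (fun t => u t i) (∑ k, M t i k * u t k) t)
    {t : ℝ} (ht : t ∈ Icc (0 : ℝ) 1) : u t = 0 := by
  have hsub : uIcc 0 t ⊆ uIcc (0 : ℝ) 1 := by
    rw [uIcc_of_le ht.1, uIcc_of_le zero_le_one]
    exact Icc_subset_Icc_right ht.2
  have hac : AbsolutelyContinuousOnInterval (fun t => ∑ i, u t i * u t i) 0 t :=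
    AbsolutelyContinuousOnInterval.fun_finset_sum _ fun i _ =>
      ((hu i).mono hsub).mul ((hu i).mono hsub)
  have hzero : ∑ i, u t i * u t i = 0 := by
    refine hac.eq_zero_of_deriv_le (K := 2 * K * n)
      (f' := fun t => ∑ i, 2 * (u t i * ∑ k, M t i k * u t k)) ht.1 (by simp [h0])
      (Finset.sum_nonneg fun i _ => mul_self_nonneg _) ?_
    filter_upwards [ae_restrict_of_ae_restrict_of_subset (Icc_subset_Icc_right ht.2) hd]
      with x ⟨hM, hx⟩
    constructor
    · refine (HasDerivAt.fun_sum (u := Finset.univ) fun i _ => (hx i).fun_mul (hx i)).congr_deriv ?_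
      exact Finset.sum_congr rfl fun i _ => by ring
    · have h1 : ∀ i k, 2 * (u x i * (M x i k * u x k)) ≤ K * (u x i * u x i + u x k * u x k) := by
        intro i k
        obtain ⟨h2, h3⟩ := abs_le.1 (hM i k)
        -- With a = u_i, b = u_k and M the entry: (K - M)(a + b)² + (K + M)(a - b)² ≥ 0 is twice the
        -- required bound 2Mab ≤ K(a² + b²).
        nlinarith [mul_nonneg (sub_nonneg.2 h3) (sq_nonneg (u x i + u x k)),
          mul_nonneg (by linarith : 0 ≤ K + M x i k) (sq_nonneg (u x i - u x k))]
      calc ∑ i, 2 * (u x i * ∑ k, M x i k * u x k)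
          = ∑ i, ∑ k, 2 * (u x i * (M x i k * u x k)) := by simp only [Finset.mul_sum]
        _ ≤ ∑ i, ∑ k, K * (u x i * u x i + u x k * u x k) :=
            Finset.sum_le_sum fun i _ => Finset.sum_le_sum fun k _ => h1 i k
        _ = 2 * K * n * ∑ i, u x i * u x i := by
            simp only [← Finset.mul_sum, Finset.sum_add_distrib, Finset.sum_const,
              Finset.card_univ, Fintype.card_fin, nsmul_eq_mul]
            have e : ∑ i, u x i * (n * u x i) = n * ∑ i, u x i * u x i := by
              rw [Finset.mul_sum]
              exact Finset.sum_congr rfl fun i _ => by ring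
            rw [e]
            ring
  funext i
  have := (Finset.sum_eq_zero_iff_of_nonneg fun i _ => mul_self_nonneg (u t i)).1 hzero i
    (Finset.mem_univ i)
  exact mul_self_eq_zero.1 this

theorem exists_ae_abs_le_of_memLp_top {ι α : Type*} [Fintype ι] [MeasurableSpace α] {μ : Measure α}
    {h : α → ι → ℝ} (hh : MemLp h ⊤ μ) : ∃ C, 0 ≤ C ∧ ∀ᵐ t ∂μ, ∀ j, |h t j| ≤ C := by
  have h1 : eLpNormEssSup h μ < ⊤ := by
    rw [← eLpNorm_exponent_top]
    exact hh.2
  refine ⟨(eLpNormEssSup h μ).toReal, ENNReal.toReal_nonneg, ?_⟩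
  filter_upwards [ae_le_eLpNormEssSup (f := h) (μ := μ)] with t ht j
  have h2 := (ENNReal.toReal_le_toReal enorm_ne_top h1.ne).2 ht
  rw [toReal_enorm] at h2
  exact (norm_le_pi_norm (h t) j).trans h2

namespace MvPolynomial

theorem contDiff_eval {n : ℕ} (p : MvPolynomial (Fin n) ℝ) :
    ContDiff ℝ 1 fun x : Fin n → ℝ => eval x p := by
  induction p using MvPolynomial.induction_on with
  | C a => simpa using contDiff_const
  | add p q hp hq => simpa only [map_add] using hp.add hq
  | mul_X p i hp => simpa only [map_mul, eval_X] using hp.mul (contDiff_apply ℝ ℝ i)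

theorem exists_lipschitzOnWith_eval_comp {n : ℕ} (p : MvPolynomial (Fin n) ℝ)
    {g : ℝ → Fin n → ℝ} {K : NNReal} (hg : LipschitzOnWith K g (Icc 0 1)) :
    ∃ K', LipschitzOnWith K' (fun t => eval (g t) p) (Icc 0 1) := by
  have hb : Bornology.IsBounded (g '' Icc 0 1) :=
    (isCompact_Icc.image_of_continuousOn hg.continuousOn).isBounded
  obtain ⟨R, hR⟩ := hb.subset_closedBall 0
  obtain ⟨K', hK'⟩ := (contDiff_eval p).contDiffOn.exists_lipschitzOnWith one_ne_zero
    (convex_closedBall (0 : Fin n → ℝ) R) (isCompact_closedBall 0 R)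
  exact ⟨_, hK'.comp hg (mapsTo_iff_image_subset.2 hR)⟩

end MvPolynomial

theorem exists_lipschitzOnWith_pi {n : ℕ} {f : ℝ → Fin n → ℝ} {t : Set ℝ}
    (h : ∀ k, ∃ K, LipschitzOnWith K (fun x => f x k) t) : ∃ K, LipschitzOnWith K f t := by
  choose K hK using h
  refine ⟨∑ k, K k, fun x hx y hy => ?_⟩
  rw [edist_pi_def]
  refine Finset.sup_le fun k _ => (hK k hx hy).trans ?_
  gcongr
  exact Finset.single_le_sum (f := K) (fun _ _ => zero_le) (Finset.mem_univ k)

/-! ### Adjoint curves and extremal polynomials along horizontal curves. -/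

namespace HallBasis
open MvPolynomial

variable {r s n : ℕ} (H : HallBasis r s n)

/-- The pairing of a covector with the value of a vector field. -/
def pairing (x ξ : Fin n → ℝ) : PolyVectorField n →ₗ[ℝ] ℝ :=
  (dotProductBilin ℝ ℝ ξ).comp (evalField x)

theorem pairing_apply (x ξ : Fin n → ℝ) (Y : PolyVectorField n) :
    pairing x ξ Y = ξ ⬝ᵥ Y.at x := rfl

theorem pairing_eq_sum (x ξ : Fin n → ℝ) (Y : PolyVectorField n) :
    pairing x ξ Y = ∑ k, ξ k * eval x (Y (X k)) := rfl

theorem eval_apply_eq_sum (x : Fin n → ℝ) (Y : PolyVectorField n) (p : MvPolynomial (Fin n) ℝ) :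
    eval x (Y p) = ∑ l, eval x (Y (X l)) * eval x (pderiv l p) := by
  rw [PolyVectorField.apply_eq_sum, map_sum]
  simp only [map_mul]

/-- Derivative of a polynomial along a horizontal curve. -/
theorem hasDerivAt_eval_horizontal {g : ℝ → Fin n → ℝ} {h : Fin r → ℝ} {t : ℝ}
    (hg : HasDerivAt g (∑ j : Fin r, h j • (H.field (H.gen j)).at (g t)) t)
    (p : MvPolynomial (Fin n) ℝ) : HasDerivAt (fun u => eval (g u) p)
      (∑ j, h j * eval (g t) (H.field (H.gen j) p)) t := by
  refine (hasDerivAt_eval_comp p hg).congr_deriv ?_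
  simp only [Finset.sum_apply, Pi.smul_apply, smul_eq_mul, Finset.sum_mul,
    eval_apply_eq_sum (g t) (H.field _) p, Finset.mul_sum]
  rw [Finset.sum_comm]
  refine Finset.sum_congr rfl fun j _ => Finset.sum_congr rfl fun l _ => ?_
  rw [mul_assoc]
  rfl

/-- Derivative of `⟨ξ, Y⟩` along a horizontal curve with an adjoint curve. -/
theorem hasDerivAt_pairing {g ξ : ℝ → Fin n → ℝ} {h : Fin r → ℝ} {t : ℝ}
    (hg : HasDerivAt g (∑ j : Fin r, h j • (H.field (H.gen j)).at (g t)) t)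
    (hξ : HasDerivAt ξ (fun k => -∑ j : Fin r, ∑ i : Fin n, eval (g t)
      (pderiv k (PolyVectorField.coeff (H.field (H.gen j)) i)) * h j * ξ t i) t)
    (Y : PolyVectorField n) : HasDerivAt (fun u => pairing (g u) (ξ u) Y)
      (∑ j, h j * pairing (g t) (ξ t) ⁅H.field (H.gen j), Y⁆) t := by
  have h1 := HasDerivAt.fun_sum (u := Finset.univ) fun k _ =>
    (hasDerivAt_pi.1 hξ k).fun_mul (H.hasDerivAt_eval_horizontal hg (Y (X k)))
  refine h1.congr_deriv ?_
  simp only [pairing_eq_sum, Derivation.commutator_apply, map_sub, mul_sub,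
    Finset.sum_sub_distrib, Finset.sum_add_distrib]
  -- The derivative of ξ accounts for the terms Y(X_j(x_k)) of the commutator, the derivative of the
  -- coefficients of Y for the terms X_j(Y(x_k)).
  have h2 : ∑ j, h j * ∑ k, ξ t k * eval (g t) (Y (H.field (H.gen j) (X k))) =
      ∑ k, (∑ j : Fin r, ∑ i : Fin n, eval (g t)
        (pderiv k (PolyVectorField.coeff (H.field (H.gen j)) i)) * h j * ξ t i) *
          eval (g t) (Y (X k)) := by
    simp only [eval_apply_eq_sum (g t) Y (H.field _ _), Finset.mul_sum, Finset.sum_mul]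
    rw [Finset.sum_comm (s := (Finset.univ : Finset (Fin n))) (t := (Finset.univ : Finset (Fin r)))]
    refine Finset.sum_congr rfl fun j _ => ?_
    rw [Finset.sum_comm]
    refine Finset.sum_congr rfl fun k _ => Finset.sum_congr rfl fun i _ => ?_
    rw [PolyVectorField.coeff]
    ring
  have h3 : ∑ j, h j * ∑ k, ξ t k * eval (g t) (H.field (H.gen j) (Y (X k))) =
      ∑ k, ξ t k * ∑ j, h j * eval (g t) (H.field (H.gen j) (Y (X k))) := by
    simp only [Finset.mul_sum]
    rw [Finset.sum_comm]
    exact Finset.sum_congr rfl fun k _ => Finset.sum_congr rfl fun j _ => by ring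
  simp only [neg_mul, Finset.sum_neg_distrib]
  rw [h2, h3]
  ring

theorem pairing_lie_field (x ξ : Fin n → ℝ) (i j : Fin n) :
    pairing x ξ ⁅H.field j, H.field i⁆ =
      ∑ k, H.basis.repr ⁅H.basis j, H.basis i⁆ k * pairing x ξ (H.field k) := by
  simp only [pairing_eq_sum, lie_field_apply, map_sum, smul_eval, Finset.mul_sum]
  rw [Finset.sum_comm]
  exact Finset.sum_congr rfl fun k _ => Finset.sum_congr rfl fun m _ => by ring

theorem absolutelyContinuousOnInterval_eval_comp (p : MvPolynomial (Fin n) ℝ)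
    {g : ℝ → Fin n → ℝ} (hg : ∃ K, LipschitzOnWith K g (Icc 0 1)) :
    AbsolutelyContinuousOnInterval (fun t => eval (g t) p) 0 1 := by
  obtain ⟨K, hg⟩ := hg
  obtain ⟨K', h⟩ := exists_lipschitzOnWith_eval_comp p hg
  rw [← uIcc_of_le zero_le_one] at h
  exact h.absolutelyContinuousOnInterval

theorem absolutelyContinuousOnInterval_pairing {g ξ : ℝ → Fin n → ℝ}
    (hg : ∃ K, LipschitzOnWith K g (Icc 0 1)) (hξ : ∃ K, LipschitzOnWith K ξ (Icc 0 1))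
    (Y : PolyVectorField n) :
    AbsolutelyContinuousOnInterval (fun t => pairing (g t) (ξ t) Y) 0 1 := by
  simp only [pairing_eq_sum]
  refine AbsolutelyContinuousOnInterval.fun_finset_sum _
    (f := fun k t => ξ t k * eval (g t) (Y (X k))) fun k _ => ?_
  have h1 : AbsolutelyContinuousOnInterval (fun t => ξ t k) 0 1 := by
    simpa only [eval_X] using absolutelyContinuousOnInterval_eval_comp (X k) hξ
  exact h1.mul (absolutelyContinuousOnInterval_eval_comp (Y (X k)) hg)

theorem abs_sum_mul_repr_le {C : ℝ} (hC : 0 ≤ C) {h : Fin r → ℝ} (hh : ∀ j, |h j| ≤ C)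
    (i k : Fin n) :
    |∑ j : Fin r, h j * H.basis.repr ⁅H.basis (H.gen j), H.basis i⁆ k| ≤
      C * ∑ j : Fin r, ∑ i, ∑ k, |H.basis.repr ⁅H.basis (H.gen j), H.basis i⁆ k| := by
  refine (Finset.abs_sum_le_sum_abs _ _).trans ?_
  rw [Finset.mul_sum]
  refine Finset.sum_le_sum fun j _ => ?_
  rw [abs_mul]
  refine mul_le_mul (hh j) ?_ (abs_nonneg _) hC
  refine (Finset.single_le_sum
    (f := fun k => |H.basis.repr ⁅H.basis (H.gen j), H.basis i⁆ k|)
    (fun _ _ => abs_nonneg _) (Finset.mem_univ k)).trans ?_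
  exact Finset.single_le_sum
    (f := fun i => ∑ k, |H.basis.repr ⁅H.basis (H.gen j), H.basis i⁆ k|)
    (fun _ _ => Finset.sum_nonneg fun _ _ => abs_nonneg _) (Finset.mem_univ i)

/-- Along a horizontal curve from the origin, the pairings of an adjoint curve with the frame are
the extremal polynomials. -/
theorem pairing_eq_eval_extremalPoly (hs : 2 ≤ s) {g ξ : ℝ → Fin n → ℝ} {h : ℝ → Fin r → ℝ}
    (hg0 : g 0 = 0) (hgL : ∃ K, LipschitzOnWith K g (Icc 0 1)) (hgh : H.IsControl g h)
    (hξL : ∃ K, LipschitzOnWith K ξ (Icc 0 1)) (hξ : H.SolvesAdjoint g h ξ)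
    {t : ℝ} (ht : t ∈ Icc (0 : ℝ) 1) (i : Fin n) :
    pairing (g t) (ξ t) (H.field i) = eval (g t) (H.extremalPoly (ξ 0) i) := by
  obtain ⟨C, hC0, hC⟩ := exists_ae_abs_le_of_memLp_top hgh.1
  have hac (p : MvPolynomial (Fin n) ℝ) := absolutelyContinuousOnInterval_eval_comp p hgL
  have hacp (i : Fin n) := absolutelyContinuousOnInterval_pairing hgL hξL (H.field i)
  have key : (fun i => pairing (g t) (ξ t) (H.field i) - eval (g t) (H.extremalPoly (ξ 0) i)) =
      0 := by
    -- The difference solves the linear system with matrix ∑_j h_j c_{ji}^k, bounded since h is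
    -- essentially bounded, and vanishes at t = 0.
    refine eq_zero_of_linear_ode
      (u := fun t i => pairing (g t) (ξ t) (H.field i) - eval (g t) (H.extremalPoly (ξ 0) i))
      (M := fun t i k => ∑ j : Fin r, h t j * H.basis.repr ⁅H.basis (H.gen j), H.basis i⁆ k)
      (K := C * ∑ j : Fin r, ∑ i, ∑ k, |H.basis.repr ⁅H.basis (H.gen j), H.basis i⁆ k|)
      (fun i => ?_) ?_ ?_ ht
    · exact (hacp i).sub (hac (H.extremalPoly (ξ 0) i))
    · funext i
      rw [hg0, eval_zero_extremalPoly, pairing_apply, field_at_zero]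
      simp
    · filter_upwards [hC, hgh.2, hξ] with t h1 h2 h3
      constructor
      · exact H.abs_sum_mul_repr_le hC0 h1
      · intro i
        refine ((H.hasDerivAt_pairing h2 h3 (H.field i)).sub
          (H.hasDerivAt_eval_horizontal h2 (H.extremalPoly (ξ 0) i))).congr_deriv ?_
        simp only [pairing_lie_field, H.field_extremalPoly hs _ (H.factors_gen _), map_sum,
          smul_eval, Finset.sum_mul, mul_sub, Finset.sum_sub_distrib, Finset.mul_sum]
        congr 1 <;>
        · rw [Finset.sum_comm]
          exact Finset.sum_congr rfl fun k _ => Finset.sum_congr rfl fun j _ => by ring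
  exact sub_eq_zero.1 (congrFun key i)

theorem pairing_dualPoly (v x : Fin n → ℝ) (i : Fin n) :
    pairing x (fun k => eval x (H.dualPoly v k)) (H.field i) = eval x (H.extremalPoly v i) := by
  rw [pairing_eq_sum, ← sum_dualPoly_mul, map_sum]
  exact Finset.sum_congr rfl fun k _ => by rw [map_mul, mul_comm]

theorem exists_extremalPoly_of_isGohExtremal (hs : 2 ≤ s) {g : ℝ → Fin n → ℝ} (hg0 : g 0 = 0)
    (hg : H.IsGohExtremal g) : ∃ v : Fin n → ℝ, v ≠ 0 ∧
      ∀ i : Fin n, (i : ℕ) < H.layerDim 1 + H.layerDim 2 →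
        ∀ t ∈ Icc (0 : ℝ) 1, eval (g t) (H.extremalPoly v i) = 0 := by
  obtain ⟨hL, h, hh, ξ, hξL, hξ0, hξ, hann⟩ := hg
  refine ⟨ξ 0, hξ0 0 (by simp), fun i hi t ht => ?_⟩
  rw [← H.pairing_eq_eval_extremalPoly hs hg0 hL hh hξL hξ ht]
  rw [lt_layerDim_add_iff] at hi
  rcases hf : H.factors i with _ | p
  · obtain ⟨j, rfl⟩ := H.exists_gen_eq hf
    exact (hann t ht).1 j
  · have h0 := H.deg_bracket i p.1 p.2 hf
    have h1 := H.one_le_deg p.1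
    have h2 := H.one_le_deg p.2
    obtain ⟨j1, hj1⟩ := H.exists_gen_eq (H.factors_eq_none_of_deg_eq_one (i := p.1) (by omega))
    obtain ⟨j2, hj2⟩ := H.exists_gen_eq (H.factors_eq_none_of_deg_eq_one (i := p.2) (by omega))
    rw [H.field_of_some hf, ← hj1, ← hj2]
    exact (hann t ht).2 j1 j2

theorem isGohExtremal_of_extremalPoly (hs : 2 ≤ s) {g : ℝ → Fin n → ℝ} (hg : H.IsHorizontal g)
    {v : Fin n → ℝ} (hv : v ≠ 0) (h : ∀ i : Fin n, (i : ℕ) < H.layerDim 1 + H.layerDim 2 →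
      ∀ t ∈ Icc (0 : ℝ) 1, eval (g t) (H.extremalPoly v i) = 0) : H.IsGohExtremal g := by
  obtain ⟨⟨K, hL⟩, u, hu⟩ := hg
  -- The dual curve is the polynomial covector field evaluated along the curve, hence Lipschitz.
  refine ⟨⟨K, hL⟩, u, hu, fun t k => eval (g t) (H.dualPoly v k),
    exists_lipschitzOnWith_pi fun k => exists_lipschitzOnWith_eval_comp _ hL, fun t _ h0 => hv ?_,
    ?_, fun t ht => ?_⟩
  · refine H.eq_zero_of_eval_extremalPoly (x := g t) fun i => ?_
    have h0 : (fun k => eval (g t) (H.dualPoly v k)) = 0 := h0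
    rw [← pairing_dualPoly, h0, pairing_apply, zero_dotProduct]
  · filter_upwards [hu.2] with t ht
    rw [hasDerivAt_pi]
    intro k
    refine (H.hasDerivAt_eval_horizontal ht (H.dualPoly v k)).congr_deriv ?_
    rw [← Finset.sum_neg_distrib]
    refine Finset.sum_congr rfl fun j _ => ?_
    rw [H.field_dualPoly hs v (H.factors_gen j), map_neg, map_sum, mul_neg, Finset.mul_sum]
    congr 1
    refine Finset.sum_congr rfl fun m _ => ?_
    rw [map_mul, PolyVectorField.coeff]
    ring
  · have hdeg (i : Fin n) (hi : H.deg i ≤ 2) :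
        pairing (g t) (fun k => eval (g t) (H.dualPoly v k)) (H.field i) = 0 := by
      rw [pairing_dualPoly]
      exact h i ((H.lt_layerDim_add_iff i).2 hi) t ht
    exact ⟨fun i => hdeg _ (by rw [H.deg_gen_eq_one]; norm_num), H.apply_lie_gen_eq_zero hs _ hdeg⟩

end HallBasis

/-! ### The equivalences. -/

theorem mainTheorem5 {r s n : ℕ} (hr : 2 ≤ r) (hs : 2 ≤ s) (H : HallBasis r s n)
    (γ : ℝ → Fin n → ℝ) (hγ : H.IsHorizontal γ) (hγ0 : γ 0 = 0) :
    (H.IsGohExtremal γ ↔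
      ∃ v : Fin n → ℝ, v ≠ 0 ∧
        ∀ i : Fin n, (i : ℕ) < H.layerDim 1 + H.layerDim 2 →
          ∀ t ∈ Set.Icc (0 : ℝ) 1, MvPolynomial.eval (γ t) (H.extremalPoly v i) = 0) ∧
    (H.IsGohExtremal γ ↔
      ∃ v : Fin n → ℝ, v ≠ 0 ∧ ∀ t ∈ Set.Icc (0 : ℝ) 1, γ t ∈ H.gohVariety v) := by
  have key : H.IsGohExtremal γ ↔ ∃ v : Fin n → ℝ, v ≠ 0 ∧
      ∀ i : Fin n, (i : ℕ) < H.layerDim 1 + H.layerDim 2 →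
        ∀ t ∈ Set.Icc (0 : ℝ) 1, MvPolynomial.eval (γ t) (H.extremalPoly v i) = 0 :=
    ⟨H.exists_extremalPoly_of_isGohExtremal hs hγ0,
      fun ⟨_, hv, h⟩ => H.isGohExtremal_of_extremalPoly hs hγ hv h⟩
  refine ⟨key, key.trans (exists_congr fun v => and_congr Iff.rfl ?_)⟩
  exact ⟨fun h t ht i hi => h i hi t ht, fun h i hi t ht => h t ht i hi⟩
end
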